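/- Let $n\ge 1$, let $q\in\mathbb C$ with $0<|q|<1$, and let $$\vartheta(t)=\vartheta(t;q)=(t^{1/2}-t^{-1/2})\prod_{k\ge1}(1-tq^k)(1-t^{-1}q^k).$$ All arguments $t$ of $\vartheta$ are given through a logarithm: $t=e^x$, $t^{1/2}=e^{x/2}$. In particular we fix logarithms of $\hbar$, of the spectral parameters $u,w$ and of the dynamical parameters $\boldsymbol z=(z_1,\dots,z_n)$, and products of parameters correspond to sums of logarithms. Put $$A(u,z)=\frac{\vartheta(z\hbar)\vartheta(z\hbar^{-1})\vartheta(u)}{\vartheta(z)^2\vartheta(u\hbar^{-1})},\quad B(u,z)=\frac{\vartheta(\hbar)\vartheta(uz)}{\vartheta(z)\vartheta(u^{-1}\hbar)},\quad C(u)=\frac{\vartheta(u)}{\vartheta(u\hbar^{-1})},\quad D(u)=\frac{\vartheta(u\hbar)}{\vartheta(u^{-1}\hbar)}.$$ Let $v_0,\dots,v_n$ be the standard basis of $\mathbb C^{n+1}$ and define $\mathbf R(u,\boldsymbol z)$ on $\mathbb C^{n+1}\otimes\mathbb C^{n+1}$ by $$\mathbf R(u,\boldsymbol z)(v_\alpha\otimes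 v_\beta)=\begin{cases}v_\alpha\otimes v_\beta,&\alpha=\beta<n,\\ D(u)\,v_\alpha\otimes v_\beta,&\alpha=\beta=n,\\ C(u)\,v_\alpha\otimes v_\beta+B\big(u,\hbar^{-\delta_{\beta,n}}\prod_{i=\alpha+1}^{\beta}z_i\big)v_\beta\otimes v_\alpha,&\alpha<\beta,\\ A\big(u,\hbar^{-\delta_{\alpha,n}}\prod_{i=\beta+1}^{\alpha}z_i\big)v_\alpha\otimes v_\beta+B\big(u,\hbar^{\delta_{\alpha,n}}\prod_{i=\beta+1}^{\alpha}z_i^{-1}\big)v_\beta\otimes v_\alpha,&\beta<\alpha.\end{cases}$$ Let $\mathsf C_{ij}=2\delta_{ij}(1-\delta_{i,n})-\delta_{i+1,j}-\delta_{i-1,j}$ $(1\le i,j\le n)$ be the symmetric Cartan matrix of $\mathfrak{sl}(n|1)$, and let $\boldsymbol\mu(v_\alpha)=(1,0,\dots,0)-\mathsf C\,(\underbrace{1,\dots,1}_{\alpha},0,\dots,0)\in\mathbb Z^n$ for $0\le\alpha\le n$. (1) The dynamical Yang–Baxter equation $$\mathbf R_{12}(u,\boldsymbol z)\,\mathbf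 R_{13}(uw,\boldsymbol z\hbar^{-\boldsymbol\mu^{(2)}})\,\mathbf R_{23}(w,\boldsymbol z)=\mathbf R_{23}(w,\boldsymbol z\hbar^{-\boldsymbol\mu^{(1)}})\,\mathbf R_{13}(uw,\boldsymbol z)\,\mathbf R_{12}(u,\boldsymbol z\hbar^{-\boldsymbol\mu^{(3)}})$$ holds whenever no denominator in the matrices occurring in it vanishes. Here $(\boldsymbol z\hbar^{-\boldsymbol\mu})_i=z_i\hbar^{-\mu_i}$, and $\boldsymbol\mu^{(k)}$ means that $\boldsymbol\mu(v_\gamma)$ is used on vectors whose $k$-th tensor factor is $v_\gamma$. (2) Explicitly, $\boldsymbol\mu(v_0)=(1,0,\dots,0)$; for $0<\alpha<n$, $\boldsymbol\mu(v_\alpha)$ has entry $-1$ at position $\alpha$, entry $1$ at position $\alpha+1$, and $0$ elsewhere; $\boldsymbol\mu(v_n)=(0,\dots,0,1)$. These are the weights of the fundamental representation $\mathbb C^{n|1}$ of $\mathfrak{sl}(n|1)$, where $v_0,\dots,v_{n-1}$ are even and $v_n$ is odd: with the Chevalley generators $e_i=E_{i-1,i}$, $f_i=E_{i,i-1}$,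 $h_i=[e_i,f_i]$ (super bracket, $1\le i\le n$), the $h_i$ form a basis of the Cartan subalgebra of diagonal supertraceless matrices, $[h_i,e_j]=\mathsf C_{ij}e_j$, $[h_i,f_j]=-\mathsf C_{ij}f_j$, and $h_iv_\alpha=\mu_i(v_\alpha)v_\alpha$. (3) The rational limit of $\mathbf R$ is $$\mathrm R(u)=\mathrm P\Big(\frac{u}{u-\hbar}\Pi-\frac{\hbar}{u-\hbar}\mathbf 1\Big),$$ where $u,\hbar\in\mathbb C$ are now additive, $\mathrm P(v_\alpha\otimes v_\beta)=v_\beta\otimes v_\alpha$ and $\Pi(v_\alpha\otimes v_\beta)=(-1)^{|v_\alpha||v_\beta|}v_\beta\otimes v_\alpha$. That is, let $s\in\mathbb R^n$ be a generic slope, meaning $\sum_{i=\alpha+1}^{\beta}s_i\notin\mathbb Z$ for all $0\le\alpha<\beta\le n$. Then, as $q\to0$ $(q\ne 0)$ with $\log|z_i|/\log|q|\to s_i$ and with $u,\hbar$ fixed, $u\ne\hbar$ as elements of $\mathbb C^\times$, the matrix $\mathbf R(u,\boldsymbol z)$ converges to a (trigonometric) matrix $T_s$ depending only on $s$ and the logarithms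 of $\hbar$ and $u$; and for all complex $u\ne\hbar$ the value of $T_s$ at $(e^{\varepsilon\hbar},e^{\varepsilon u})$, with logarithms $\varepsilon\hbar,\varepsilon u$, converges to $\mathrm R(u)$ as $\varepsilon\to0$, $\varepsilon\neq 0$. -/

import Mathlib

open Filter Topology

noncomputable section

namespace SuperR

/-- The odd elliptic theta function in the additive variable `x`, where `t = exp x`:
`(t^{1/2} - t^{-1/2}) ∏_{k ≥ 1} (1 - t q^k) (1 - t⁻¹ q^k)` with `t^{1/2} = exp (x / 2)`. -/
def theta (q x : ℂ) : ℂ :=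
  (Complex.exp (x / 2) - Complex.exp (-(x / 2))) *
    ∏' k : ℕ, ((1 - Complex.exp x * q ^ (k + 1)) * (1 - Complex.exp (-x) * q ^ (k + 1)))

/-! The four functions, with all arguments (including `h`, the parameter `ħ`) additive. -/

def fA (q h u z : ℂ) : ℂ :=
  (theta q (z + h) * theta q (z - h) * theta q u) / (theta q z ^ 2 * theta q (u - h))

def fB (q h u z : ℂ) : ℂ :=
  (theta q h * theta q (u + z)) / (theta q z * theta q (-u + h))

def fC (q h u : ℂ) : ℂ := theta q u / theta q (u - h)

def fD (q h u : ℂ) : ℂ := theta q (u + h) / theta q (-u + h)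

/-- Labels of the basis `v_0, …, v_n` of `ℂ^{n+1}`. -/
abbrev Idx (n : ℕ) := Fin (n + 1)

/-- Operators on `ℂ^{n+1} ⊗ ℂ^{n+1}` in the basis `v_α ⊗ v_β` (row: output, column: input). -/
abbrev Op2 (n : ℕ) := Matrix (Idx n × Idx n) (Idx n × Idx n) ℂ

/-- Operators on `ℂ^{n+1} ⊗ ℂ^{n+1} ⊗ ℂ^{n+1}` in the basis `v_α ⊗ v_β ⊗ v_γ`. -/
abbrev Op3 (n : ℕ) := Matrix (Idx n × Idx n × Idx n) (Idx n × Idx n × Idx n) ℂ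

/-- `∑_{i = α+1}^{β} z_i`. The node `i ∈ {1, …, n}` is the element `i - 1` of `Fin n`. -/
def zsum {n : ℕ} {M : Type*} [AddCommMonoid M] (z : Fin n → M) (α β : Idx n) : M :=
  ∑ j : Fin n, if α ≤ j.castSucc ∧ j.castSucc < β then z j else 0

/-- `ħ δ_{α,n}`. -/
def hdelta {n : ℕ} (h : ℂ) (α : Idx n) : ℂ := if α = Fin.last n then h else 0

/-- The basis vector `v_α ⊗ v_β`. -/
def tens {n : ℕ} (α β : Idx n) : Idx n × Idx n → ℂ := Pi.single (α, β) 1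

/-- The vector `R(u, z) (v_α ⊗ v_β)`. -/
def rApply {n : ℕ} (q h u : ℂ) (z : Fin n → ℂ) (α β : Idx n) : Idx n × Idx n → ℂ :=
  if α = β then
    if α = Fin.last n then fD q h u • tens α β else tens α β
  else if α < β then
    fC q h u • tens α β + fB q h u (zsum z α β - hdelta h β) • tens β α
  else
    fA q h u (zsum z β α - hdelta h α) • tens α β +
      fB q h u (-zsum z β α + hdelta h α) • tens β α

/-- The elliptic dynamical R-matrix. -/
def rMat {n : ℕ} (q h u : ℂ) (z : Fin n → ℂ) : Op2 n :=
  Matrix.of fun p s => rApply q h u z s.1 s.2 p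

/-- No denominator depending on the spectral parameter vanishes. -/
def RegularU (q h u : ℂ) : Prop := theta q (u - h) ≠ 0

/-- No denominator depending on the dynamical parameter vanishes. -/
def RegularZ {n : ℕ} (q h : ℂ) (z : Fin n → ℂ) : Prop :=
  ∀ α β : Idx n, α < β → theta q (zsum z α β - hdelta h β) ≠ 0

/-! Placing a family of operators on two of the three tensor factors. The operator may depend
on the label of the basis vector that sits in the remaining, untouched factor. -/

def leg12 {n : ℕ} (f : Idx n → Op2 n) : Op3 n :=
  Matrix.of fun p s =>
    if p.2.2 = s.2.2 then f s.2.2 (p.1, p.2.1) (s.1, s.2.1) else 0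

def leg13 {n : ℕ} (f : Idx n → Op2 n) : Op3 n :=
  Matrix.of fun p s =>
    if p.2.1 = s.2.1 then f s.2.1 (p.1, p.2.2) (s.1, s.2.2) else 0

def leg23 {n : ℕ} (f : Idx n → Op2 n) : Op3 n :=
  Matrix.of fun p s =>
    if p.1 = s.1 then f s.1 (p.2.1, p.2.2) (s.2.1, s.2.2) else 0

/-- The symmetric Cartan matrix of `sl(n|1)`:
`2 δ_{i,j} (1 - δ_{i,n}) - δ_{i+1,j} - δ_{i-1,j}` for nodes `1 ≤ i, j ≤ n`. -/
def cartanMatrix (n : ℕ) : Matrix (Fin n) (Fin n) ℤ :=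
  Matrix.of fun i j =>
    2 * (if i = j then 1 else 0) * (1 - (if i.val + 1 = n then 1 else 0))
      - (if i.val + 1 = j.val then 1 else 0) - (if i.val = j.val + 1 then 1 else 0)

/-- The gauge dimension vector `v_α = (1, …, 1, 0, …, 0)` with `α` ones. -/
def gaugeDim {n : ℕ} (α : Idx n) : Fin n → ℤ := fun i => if i.val < α.val then 1 else 0

/-- The framing dimension vector `w = (1, 0, …, 0)`. -/
def framingDim (n : ℕ) : Fin n → ℤ := fun i => if i.val = 0 then 1 else 0

/-- The dynamical shift `μ(v_α) = w - C v_α`. -/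
def mu {n : ℕ} (α : Idx n) : Fin n → ℤ := framingDim n - (cartanMatrix n).mulVec (gaugeDim α)

/-- `z - ħ μ(v_γ)`. -/
def shift {n : ℕ} (h : ℂ) (z : Fin n → ℂ) (γ : Idx n) : Fin n → ℂ :=
  fun i => z i - h * (mu γ i : ℂ)

/-! The Lie superalgebra `sl(n|1)` and its fundamental representation `ℂ^{n|1}`, in which
`v_0, …, v_{n-1}` are even and `v_n` is odd. -/

/-- The parity `|v_α|`. -/
def parity {n : ℕ} (α : Idx n) : ℕ := if α = Fin.last n then 1 else 0

def superTrace {n : ℕ} : Matrix (Idx n) (Idx n) ℂ →ₗ[ℂ] ℂ where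
  toFun M := ∑ α, (-1) ^ parity α * M α α
  map_add' M N := by simp [mul_add, Finset.sum_add_distrib]
  map_smul' c M := by simp [Finset.mul_sum, mul_left_comm]

/-- The underlying space of `sl(n|1)`: matrices of vanishing supertrace. -/
def slSuper (n : ℕ) : Submodule ℂ (Matrix (Idx n) (Idx n) ℂ) := LinearMap.ker superTrace

def oddPart {n : ℕ} (M : Matrix (Idx n) (Idx n) ℂ) : Matrix (Idx n) (Idx n) ℂ :=
  Matrix.of fun α β => if parity α = parity β then 0 else M α β

/-- The bilinear extension of `[M, N] = M N - (-1)^{|M||N|} N M` from homogeneous matrices: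
the sign differs from that of the commutator only on the product of the odd parts. -/
def superBracket {n : ℕ} (M N : Matrix (Idx n) (Idx n) ℂ) : Matrix (Idx n) (Idx n) ℂ :=
  M * N - N * M + (2 : ℂ) • (oddPart N * oddPart M)

/-- The diagonal Cartan subalgebra of `sl(n|1)`. -/
def cartanSub (n : ℕ) : Submodule ℂ (Matrix (Idx n) (Idx n) ℂ) :=
  slSuper n ⊓ LinearMap.range (Matrix.diagonalLinearMap (Idx n) ℂ ℂ)

/-! The Chevalley generators: for the node `i`, `e_i = E_{i-1,i}`, `f_i = E_{i,i-1}` and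
`h_i = [e_i, f_i]`. -/

def chevE {n : ℕ} (i : Fin n) : Matrix (Idx n) (Idx n) ℂ := Matrix.single i.castSucc i.succ 1

def chevF {n : ℕ} (i : Fin n) : Matrix (Idx n) (Idx n) ℂ := Matrix.single i.succ i.castSucc 1

def chevH {n : ℕ} (i : Fin n) : Matrix (Idx n) (Idx n) ℂ := superBracket (chevE i) (chevF i)

/-! The rational limit. -/

/-- The swap `P (v_α ⊗ v_β) = v_β ⊗ v_α`. -/
def swapP (n : ℕ) : Op2 n := Matrix.of fun p s => tens s.2 s.1 p

/-- The super swap `Π (v_α ⊗ v_β) = (-1)^{|v_α| |v_β|} v_β ⊗ v_α`. -/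
def superSwap (n : ℕ) : Op2 n :=
  Matrix.of fun p s => (-1) ^ (parity s.1 * parity s.2) * tens s.2 s.1 p

/-- `P (u / (u - ħ) Π - ħ / (u - ħ) 1)`. -/
def rRat (n : ℕ) (h u : ℂ) : Op2 n :=
  swapP n * ((u / (u - h)) • superSwap n - (h / (u - h)) • (1 : Op2 n))

/-- A slope is generic if `∑_{i = α+1}^{β} s_i` is not an integer for any `α < β`. -/
def GenericSlope {n : ℕ} (s : Fin n → ℝ) : Prop :=
  ∀ α β : Idx n, α < β → ∀ k : ℤ, zsum s α β ≠ (k : ℝ)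

/-- The regime `q → 0`, `q ≠ 0`, with the dynamical parameters `exp (z_i)` scaling like
`q ^ s_i`, that is `log |exp (z_i)| / log |q| → s_i`. -/
def slopeFilter {n : ℕ} (s : Fin n → ℝ) : Filter (ℂ × (Fin n → ℂ)) :=
  comap Prod.fst (𝓝[≠] (0 : ℂ)) ⊓
    comap (fun p i => (p.2 i).re / Real.log ‖p.1‖) (𝓝 s)

end SuperR

end

noncomputable section

namespace SuperR

/-! ### Bilateral Gaussian sums -/

/-! The Yang–Baxter equation comes down to the Weierstrass three-term identity. By the Jacobi triple
product, theta is a Gaussian sum (`theta_eq_gaussSum`). Sorting the double series for θ(x+y)θ(x−y)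
by parity (`gaussSum_mul_gaussSum`) makes it a 2×2 determinant of a vector depending on x and one
depending on y, so `theta_three_term` is the Plücker relation for four vectors in a plane.

Pull out the common factor 1/θ(u−ħ) and replace the dynamical parameters by potentials ξ_α whose
differences are the arguments in R, the correction ħδ_{α,n} being absorbed into ξ_n
(`rMat_eq_numOp`). The shift by μ(v_γ) then moves ξ_γ alone, by +ħ for even and −ħ for odd γ, up to
a common constant that R does not see (`exists_pot_shift`). For distinct labels the equation splits
into two scalar identities, `exch_three` and `exch_cubic`. Repeated labels are specialisations of
these: for a label of sign σ the diagonal amplitude is the exchange amplitude at difference −σħ,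
where `trans2` vanishes. The odd label is thus the even one with ħ replaced by −ħ.

For the weights, h_i is diagonal with entries μ_i(v_α) (`chevH_eq_diagonal`), and partial sums of
diagonal entries are coordinates dual to the h_i.

For the limit, θ(x+u)/θ(x) along x of slope σ ∉ ℤ tends to exp(−(⌊σ⌋+1/2)u)
(`tendsto_theta_div_theta`). Hence the two transmission amplitudes acquire the same limit, and the
slope survives only in an exponential factor of the exchange term. Under rational scaling this
factor tends to 1 and quotients of hyperbolic sines become quotients of their arguments. -/

/-- The general term of the bilateral series `∑ exp (L l² + x l)`. -/
def gaussTerm (L x : ℂ) (l : ℤ) : ℂ := Complex.exp (L * (l : ℂ) ^ 2 + x * l)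

/-- The bilateral series `∑ exp (L l² + x l)`. -/
def gaussSum (L x : ℂ) : ℂ := ∑' l : ℤ, gaussTerm L x l

/-- These are the terms of Jacobi's two-variable theta function with τ = L/(πi); Re L < 0 means Im τ
> 0. -/
lemma summable_norm_gaussTerm {L : ℂ} (hL : L.re < 0) (x : ℂ) :
    Summable fun l => ‖gaussTerm L x l‖ := by
  have hpi : (Real.pi : ℂ) ≠ 0 := by exact_mod_cast Real.pi_ne_zero
  have h : Summable (jacobiTheta₂_term · (x / (2 * Real.pi * Complex.I))
      (L / (Real.pi * Complex.I))) := by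
    rw [summable_jacobiTheta₂_term_iff]
    have : L / (Real.pi * Complex.I) = ((-1 / Real.pi : ℝ) : ℂ) * (L * Complex.I) := by
      push_cast
      field_simp
      rw [Complex.I_sq]; ring
    rw [this, Complex.im_ofReal_mul, Complex.mul_I_im]
    have := Real.pi_pos
    exact mul_pos_of_neg_of_neg (div_neg_of_neg_of_pos (by norm_num) this) hL
  refine h.norm.congr fun l => ?_
  rw [jacobiTheta₂_term, gaussTerm]
  congr 2
  field_simp
  ring

/-- The bijection `(a, b) ↦ (a + b, a - b)`, `(a, b) ↦ (a + b + 1, a - b)` onto the pairs of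
integers of equal and of opposite parity. -/
def parityEquiv : (ℤ × ℤ) ⊕ (ℤ × ℤ) ≃ ℤ × ℤ where
  toFun := Sum.elim (fun p => (p.1 + p.2, p.1 - p.2)) (fun p => (p.1 + p.2 + 1, p.1 - p.2))
  invFun p := if (p.1 + p.2) % 2 = 0 then .inl ((p.1 + p.2) / 2, (p.1 - p.2) / 2)
    else .inr ((p.1 + p.2 - 1) / 2, (p.1 - p.2 - 1) / 2)
  left_inv := by
    rintro (⟨a, b⟩ | ⟨a, b⟩)
    · refine (if_pos (show (a + b + (a - b)) % 2 = 0 by omega)).trans ?_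
      refine congrArg Sum.inl (Prod.ext ?_ ?_)
      · change (a + b + (a - b)) / 2 = a
        omega
      · change (a + b - (a - b)) / 2 = b
        omega
    · refine (if_neg (show ¬ (a + b + 1 + (a - b)) % 2 = 0 by omega)).trans ?_
      refine congrArg Sum.inr (Prod.ext ?_ ?_)
      · change (a + b + 1 + (a - b) - 1) / 2 = a
        omega
      · change (a + b + 1 - (a - b) - 1) / 2 = b
        omega
  right_inv := by
    rintro ⟨a, b⟩
    dsimp only
    split_ifs with h
    · simp only [Sum.elim_inl, Prod.mk.injEq]; omega
    · simp only [Sum.elim_inr, Prod.mk.injEq]; omega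

lemma gaussSum_shift (L x : ℂ) :
    gaussSum L (2 * x - L) = Complex.exp (2 * x) * gaussSum L (2 * x + L) := by
  rw [gaussSum, gaussSum, ← tsum_mul_left, ← (Equiv.addRight (1 : ℤ)).tsum_eq]
  refine tsum_congr fun l => ?_
  simp only [gaussTerm, Equiv.coe_addRight, ← Complex.exp_add]
  congr 1
  push_cast
  ring

/-- The even part in the addition formula of theta functions. -/
def evenSum (L x : ℂ) : ℂ := gaussSum L (2 * x)

/-- The odd part in the addition formula of theta functions. -/
def oddSum (L x : ℂ) : ℂ := Complex.exp x * gaussSum L (2 * x + L)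

/-- In the coordinates of `parityEquiv` the quadratic form (l² + m²)/2 loses its cross term, so each
parity class of the double sum factors into a series in x times a series in y. The minus sign is
exp(πi(l+m)) on pairs of opposite parity. -/
lemma gaussSum_mul_gaussSum {L : ℂ} (hL : L.re < 0) (x y : ℂ) :
    Complex.exp (-x) * (gaussSum (L / 2) (x + y + Real.pi * Complex.I - L / 2) *
      gaussSum (L / 2) (x - y + Real.pi * Complex.I - L / 2)) =
    oddSum L x * evenSum L y - evenSum L x * oddSum L y := by
  have hL2 : (L / 2).re < 0 := by
    rw [Complex.div_ofNat_re]; linarith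
  have s1 := summable_norm_gaussTerm hL2 (x + y + Real.pi * Complex.I - L / 2)
  have s2 := summable_norm_gaussTerm hL2 (x - y + Real.pi * Complex.I - L / 2)
  have e1 : ∀ a b : ℤ, gaussTerm (L / 2) (x + y + Real.pi * Complex.I - L / 2) (a + b) *
      gaussTerm (L / 2) (x - y + Real.pi * Complex.I - L / 2) (a - b) =
      gaussTerm L (2 * x - L) a * gaussTerm L (2 * y) b := by
    intro a b
    simp only [gaussTerm, ← Complex.exp_add]
    -- The exponents agree only modulo 2πi: the half-period terms add up to πi((a+b)+(a−b)) = 2πi·a.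
    rw [Complex.exp_eq_exp_iff_exists_int]
    refine ⟨a, ?_⟩
    push_cast
    ring
  have e2 : ∀ a b : ℤ, gaussTerm (L / 2) (x + y + Real.pi * Complex.I - L / 2) (a + b + 1) *
      gaussTerm (L / 2) (x - y + Real.pi * Complex.I - L / 2) (a - b) =
      -(Complex.exp x * Complex.exp y) *
        (gaussTerm L (2 * x) a * gaussTerm L (2 * y + L) b) := by
    intro a b
    rw [neg_mul, ← neg_one_mul, ← Complex.exp_pi_mul_I]
    simp only [gaussTerm, ← Complex.exp_add]
    rw [Complex.exp_eq_exp_iff_exists_int]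
    refine ⟨a, ?_⟩
    push_cast
    ring
  have key : gaussSum (L / 2) (x + y + Real.pi * Complex.I - L / 2) *
      gaussSum (L / 2) (x - y + Real.pi * Complex.I - L / 2) =
      gaussSum L (2 * x - L) * gaussSum L (2 * y) +
        -(Complex.exp x * Complex.exp y) * (gaussSum L (2 * x) * gaussSum L (2 * y + L)) := by
    have t1 := tsum_mul_tsum_of_summable_norm (summable_norm_gaussTerm hL (2 * x - L))
      (summable_norm_gaussTerm hL (2 * y))
    have t2 := tsum_mul_tsum_of_summable_norm (summable_norm_gaussTerm hL (2 * x))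
      (summable_norm_gaussTerm hL (2 * y + L))
    have u1 := summable_mul_of_summable_norm (summable_norm_gaussTerm hL (2 * x - L))
      (summable_norm_gaussTerm hL (2 * y))
    have u2 := summable_mul_of_summable_norm (summable_norm_gaussTerm hL (2 * x))
      (summable_norm_gaussTerm hL (2 * y + L))
    simp only [gaussSum]
    rw [tsum_mul_tsum_of_summable_norm s1 s2, t1, t2, ← tsum_mul_left,
      ← parityEquiv.tsum_eq]
    have v1 := u1.hasSum
    have v2 := (u2.mul_left (-(Complex.exp x * Complex.exp y))).hasSum
    simp only [← e1] at v1 ⊢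
    simp only [← e2] at v2 ⊢
    exact HasSum.tsum_eq (HasSum.sum v1 v2)
  rw [key, gaussSum_shift, oddSum, evenSum, oddSum, evenSum, two_mul x, Complex.exp_add]
  have : Complex.exp (-x) * Complex.exp x = 1 := by rw [← Complex.exp_add]; simp
  linear_combination (Complex.exp x * gaussSum L (x + x + L) * gaussSum L (2 * y)
    - Complex.exp y * gaussSum L (x + x) * gaussSum L (2 * y + L)) * this

/-! ### The Jacobi triple product -/

/-- The finite `q`-Pochhammer symbol `(q; q)_m`. -/
def qPoch (q : ℂ) (m : ℕ) : ℂ := ∏ k ∈ Finset.range m, (1 - q ^ (k + 1))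

/-- The Gaussian binomial coefficient as a quotient of `q`-Pochhammer symbols. -/
def gaussBinom (q : ℂ) (m j : ℕ) : ℂ := qPoch q m / (qPoch q j * qPoch q (m - j))

lemma one_sub_pow_ne_zero {q : ℂ} (hq : ‖q‖ < 1) (k : ℕ) : 1 - q ^ (k + 1) ≠ 0 := by
  intro h
  have h1 : ‖q ^ (k + 1)‖ = 1 := by rw [← sub_eq_zero.mp h]; simp
  rw [norm_pow] at h1
  exact (pow_lt_one₀ (norm_nonneg q) hq (Nat.succ_ne_zero k)).ne h1

lemma qPoch_ne_zero {q : ℂ} (hq : ‖q‖ < 1) (m : ℕ) : qPoch q m ≠ 0 :=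
  Finset.prod_ne_zero_iff.mpr fun k _ => one_sub_pow_ne_zero hq k

lemma qPoch_succ (q : ℂ) (m : ℕ) : qPoch q (m + 1) = qPoch q m * (1 - q ^ (m + 1)) :=
  Finset.prod_range_succ _ _

lemma gaussBinom_zero_right {q : ℂ} (hq : ‖q‖ < 1) (m : ℕ) : gaussBinom q m 0 = 1 := by
  have := qPoch_ne_zero hq m
  simp [gaussBinom, show qPoch q 0 = 1 by simp [qPoch], this]

lemma gaussBinom_self {q : ℂ} (hq : ‖q‖ < 1) (m : ℕ) : gaussBinom q m m = 1 := by
  have := qPoch_ne_zero hq m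
  simp [gaussBinom, show qPoch q 0 = 1 by simp [qPoch], this]

/-- The q-Pascal rule. The bound keeps the natural subtraction honest; the two end coefficients are
treated separately in the q-binomial theorem. -/
lemma gaussBinom_succ {q : ℂ} (hq : ‖q‖ < 1) {m j : ℕ} (hj : j + 1 ≤ m) :
    gaussBinom q (m + 1) (j + 1) = gaussBinom q m (j + 1) + q ^ (m - j) * gaussBinom q m j := by
  obtain ⟨d, rfl⟩ := Nat.exists_eq_add_of_le hj
  have h1 : j + 1 + d + 1 - (j + 1) = d + 1 := by omega
  have h2 : j + 1 + d - (j + 1) = d := by omega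
  have h3 : j + 1 + d - j = d + 1 := by omega
  simp only [gaussBinom, h1, h2, h3, qPoch_succ q d, qPoch_succ q j, qPoch_succ q (j + 1 + d)]
  have a1 := qPoch_ne_zero hq j
  have a2 := qPoch_ne_zero hq d
  have a3 := one_sub_pow_ne_zero hq j
  have a4 := one_sub_pow_ne_zero hq d
  field_simp
  ring

/-- The `q`-binomial theorem. -/
lemma prod_one_add_mul_pow {q : ℂ} (hq : ‖q‖ < 1) (x : ℂ) (m : ℕ) :
    ∏ k ∈ Finset.range m, (1 + x * q ^ k) =
      ∑ j ∈ Finset.range (m + 1), gaussBinom q m j * q ^ (j.choose 2) * x ^ j := by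
  induction m with
  | zero => simp [gaussBinom_self hq]
  | succ m ih =>
    rw [Finset.prod_range_succ, ih, mul_add, mul_one]
    conv_lhs =>
      arg 1
      rw [Finset.sum_range_succ']
    conv_lhs =>
      arg 2
      rw [Finset.sum_range_succ]
    rw [Finset.sum_range_succ, Finset.sum_range_succ', gaussBinom_self hq, gaussBinom_self hq,
      gaussBinom_zero_right hq, gaussBinom_zero_right hq, Nat.choose_succ_succ' m 1]
    have : ∀ j ∈ Finset.range m, gaussBinom q (m + 1) (j + 1) * q ^ ((j + 1).choose 2) *
        x ^ (j + 1) = gaussBinom q m (j + 1) * q ^ ((j + 1).choose 2) * x ^ (j + 1) +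
          gaussBinom q m j * q ^ (j.choose 2) * x ^ j * (x * q ^ m) := by
      intro j hj
      have hj' := Finset.mem_range.mp hj
      rw [gaussBinom_succ hq hj', Nat.choose_succ_succ' j 1, Nat.choose_one_right]
      have : q ^ m = q ^ (m - j) * q ^ j := by rw [← pow_add]; congr 1; omega
      rw [this]
      simp only [pow_add]
      ring
    rw [Finset.sum_congr rfl this, Finset.sum_add_distrib, ← Finset.sum_mul, Nat.choose_one_right,
      pow_add, pow_succ]
    ring

lemma re_log_neg {q L : ℂ} (hL : Complex.exp L = q) (hq : ‖q‖ < 1) : L.re < 0 := by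
  rw [← hL, Complex.norm_exp] at hq
  exact Real.exp_lt_one_iff.mp hq

lemma prod_mul_pow_range (x q : ℂ) (N : ℕ) :
    ∏ k ∈ Finset.range N, (x * q ^ k) = q ^ (N.choose 2) * x ^ N := by
  induction N with
  | zero => simp
  | succ N ih =>
    rw [Finset.prod_range_succ, ih, Nat.choose_succ_succ' N 1, Nat.choose_one_right, pow_add]
    ring

/-- The finite form of the Jacobi triple product. -/
lemma finite_triple_product {q L : ℂ} (hL : Complex.exp L = q) (hq : ‖q‖ < 1) (x : ℂ) (N : ℕ) :
    ∏ i ∈ Finset.range N, ((1 - Complex.exp x * q ^ i) * (1 - Complex.exp (-x) * q ^ (i + 1))) =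
      ∑ j ∈ Finset.range (2 * N + 1), gaussBinom q (2 * N) j *
        gaussTerm (L / 2) (x + Real.pi * Complex.I - L / 2) (j - N) := by
  -- y = −e^x q^{−N} centres the 2N factors of the q-binomial theorem: the upper half gives 1 − e^x
  -- q^k, and the lower half, read backwards with y q^{N−1−k} extracted, gives 1 − e^{−x} q^{k+1}.
  set y : ℂ := Complex.exp (x + Real.pi * Complex.I - N * L) with hy
  have hpow : ∀ k : ℕ, q ^ k = Complex.exp (k * L) := fun k => by rw [← hL, Complex.exp_nat_mul]
  have hterm : ∀ j : ℕ, q ^ (j.choose 2) * y ^ j =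
      Complex.exp (L * (j * (j - 1) / 2) + j * (x + Real.pi * Complex.I - N * L)) := fun j => by
    rw [hpow, hy, ← Complex.exp_nat_mul, ← Complex.exp_add, Nat.cast_choose_two]
    congr 1
    ring
  have hsplit := prod_one_add_mul_pow hq y (2 * N)
  rw [two_mul, Finset.prod_range_add, ← Finset.prod_range_reflect, ← two_mul] at hsplit
  have h1 : ∀ k ∈ Finset.range N, 1 + y * q ^ (N - 1 - k) =
      (y * q ^ (N - 1 - k)) * (1 - Complex.exp (-x) * q ^ (k + 1)) := fun k hk => by
    have hk := Finset.mem_range.mp hk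
    rw [mul_sub, mul_one, add_comm, sub_eq_add_neg]
    congr 1
    rw [eq_comm, neg_eq_iff_add_eq_zero, hpow, hpow, hy, ← Complex.exp_add, ← Complex.exp_add,
      ← Complex.exp_add, Nat.sub_sub, Nat.cast_sub (by omega)]
    have : x + Real.pi * Complex.I - N * L + ((N : ℂ) - ((1 + k : ℕ) : ℂ)) * L +
        (-x + ((k + 1 : ℕ) : ℂ) * L) = Real.pi * Complex.I := by push_cast; ring
    rw [this, Complex.exp_pi_mul_I]
    ring
  have h2 : ∀ k ∈ Finset.range N, 1 + y * q ^ (N + k) = 1 - Complex.exp x * q ^ k :=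
    fun k _ => by
    rw [sub_eq_add_neg, ← neg_mul, ← neg_one_mul, ← Complex.exp_pi_mul_I, hpow, hpow, hy,
      ← Complex.exp_add, ← Complex.exp_add, ← Complex.exp_add]
    congr 2
    push_cast
    ring
  rw [Finset.prod_congr rfl h1, Finset.prod_congr rfl h2, Finset.prod_mul_distrib,
    Finset.prod_range_reflect (fun k => y * q ^ k), prod_mul_pow_range, hterm] at hsplit
  refine mul_left_cancel₀ (Complex.exp_ne_zero (L * (N * (N - 1) / 2) +
    N * (x + Real.pi * Complex.I - N * L))) ?_
  rw [Finset.prod_mul_distrib, mul_comm (∏ i ∈ Finset.range N, (1 - Complex.exp x * q ^ i)),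
    ← mul_assoc, hsplit, Finset.mul_sum]
  refine Finset.sum_congr rfl fun j _ => ?_
  rw [mul_assoc, hterm, mul_left_comm, gaussTerm, ← Complex.exp_add]
  congr 2
  push_cast
  ring

lemma summable_norm_mul_pow {q : ℂ} (hq : ‖q‖ < 1) (c : ℂ) :
    Summable fun k : ℕ => ‖-(c * q ^ (k + 1))‖ := by
  simp only [norm_neg, norm_mul, norm_pow]
  exact (((summable_nat_add_iff 1).mpr
    (summable_geometric_of_lt_one (norm_nonneg q) hq)).mul_left _)

lemma multipliable_one_sub {q : ℂ} (hq : ‖q‖ < 1) (c : ℂ) :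
    Multipliable fun k : ℕ => (1 - c * q ^ (k + 1)) := by
  simpa only [sub_eq_add_neg] using multipliable_one_add_of_summable (summable_norm_mul_pow hq c)

/-- The infinite `q`-Pochhammer symbol `(q; q)_∞`. -/
def qPochInf (q : ℂ) : ℂ := ∏' k : ℕ, (1 - q ^ (k + 1))

lemma tendsto_qPoch {q : ℂ} (hq : ‖q‖ < 1) : Tendsto (qPoch q) atTop (𝓝 (qPochInf q)) := by
  have h := multipliable_one_sub hq 1
  simp only [one_mul] at h
  exact h.hasProd.tendsto_prod_nat

lemma qPochInf_ne_zero {q : ℂ} (hq : ‖q‖ < 1) : qPochInf q ≠ 0 := by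
  have h := tprod_one_add_ne_zero_of_summable (f := fun k : ℕ => -(1 * q ^ (k + 1)))
    (fun k => by simpa [← sub_eq_add_neg] using one_sub_pow_ne_zero hq k)
    (summable_norm_mul_pow hq 1)
  simpa only [qPochInf, one_mul, sub_eq_add_neg] using h

lemma tendsto_gaussBinom {q : ℂ} (hq : ‖q‖ < 1) (l : ℤ) :
    Tendsto (fun N : ℕ => gaussBinom q (2 * N) (N + l).toNat) atTop (𝓝 (qPochInf q)⁻¹) := by
  have h0 := qPochInf_ne_zero hq
  have t := tendsto_qPoch hq
  have a1 : Tendsto (fun N : ℕ => 2 * N) atTop atTop :=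
    tendsto_atTop_atTop.mpr fun b => ⟨b, fun a _ => by omega⟩
  have a2 : Tendsto (fun N : ℕ => ((N : ℤ) + l).toNat) atTop atTop :=
    tendsto_atTop_atTop.mpr fun b => ⟨b + l.natAbs, fun a _ => by omega⟩
  have a3 : Tendsto (fun N : ℕ => 2 * N - ((N : ℤ) + l).toNat) atTop atTop :=
    tendsto_atTop_atTop.mpr fun b => ⟨b + l.natAbs, fun a _ => by omega⟩
  have := (t.comp a1).div ((t.comp a2).mul (t.comp a3)) (mul_ne_zero h0 h0)
  refine this.congr' ?_ |>.trans (le_of_eq ?_)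
  · exact Eventually.of_forall fun N => rfl
  · congr 1
    field_simp

/-- Supplies the uniform majorant for the limit N → ∞ in the triple product. -/
lemma exists_norm_gaussBinom_le {q : ℂ} (hq : ‖q‖ < 1) :
    ∃ C : ℝ, ∀ m j : ℕ, ‖gaussBinom q m j‖ ≤ C := by
  have t := tendsto_qPoch hq
  obtain ⟨A, hA⟩ := (Metric.isBounded_range_of_tendsto _ t).exists_norm_le
  obtain ⟨B, hB⟩ := (Metric.isBounded_range_of_tendsto _
    (t.inv₀ (qPochInf_ne_zero hq))).exists_norm_le
  have hA' : ∀ m, ‖qPoch q m‖ ≤ A := fun m => hA _ ⟨m, rfl⟩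
  have hB' : ∀ m, ‖(qPoch q m)⁻¹‖ ≤ B := fun m => hB _ ⟨m, rfl⟩
  have hA0 := (norm_nonneg _).trans (hA' 0)
  have hB0 := (norm_nonneg _).trans (hB' 0)
  refine ⟨A * (B * B), fun m j => ?_⟩
  rw [gaussBinom, div_eq_mul_inv, mul_inv, norm_mul, norm_mul]
  exact mul_le_mul (hA' _) (mul_le_mul (hB' _) (hB' _) (norm_nonneg _) hB0)
    (by positivity) hA0

/-- The Jacobi triple product. -/
lemma triple_product {q L : ℂ} (hL : Complex.exp L = q) (hq : ‖q‖ < 1) (x : ℂ) :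
    (1 - Complex.exp x) *
      ∏' k : ℕ, ((1 - Complex.exp x * q ^ (k + 1)) * (1 - Complex.exp (-x) * q ^ (k + 1))) =
    (qPochInf q)⁻¹ * gaussSum (L / 2) (x + Real.pi * Complex.I - L / 2) := by
  have hL2 : (L / 2).re < 0 := by
    have := re_log_neg hL hq
    rw [Complex.div_ofNat_re]; linarith
  set G := gaussTerm (L / 2) (x + Real.pi * Complex.I - L / 2) with hG
  have lim1 : Tendsto (fun N : ℕ => ∏ i ∈ Finset.range N,
      ((1 - Complex.exp x * q ^ i) * (1 - Complex.exp (-x) * q ^ (i + 1)))) atTop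
      (𝓝 ((1 - Complex.exp x) * ∏' k : ℕ,
        ((1 - Complex.exp x * q ^ (k + 1)) * (1 - Complex.exp (-x) * q ^ (k + 1))))) := by
    have h := ((multipliable_one_sub hq (Complex.exp x)).mul
      (multipliable_one_sub hq (Complex.exp (-x)))).hasProd.tendsto_prod_nat
    have h1 : Tendsto (fun N : ℕ => 1 - Complex.exp x * q ^ N) atTop (𝓝 1) := by
      simpa using ((tendsto_pow_atTop_nhds_zero_of_norm_lt_one hq).const_mul
        (Complex.exp x)).const_sub 1
    -- Multiplying by 1 − e^x and dividing by 1 − e^x q^N → 1 moves the exponents of the first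
    -- factor from 1, …, N to 0, …, N−1.
    have h2 := (h.const_mul (1 - Complex.exp x)).div h1 one_ne_zero
    rw [div_one] at h2
    refine h2.congr' ?_
    filter_upwards [h1.eventually_ne one_ne_zero] with N hN
    rw [Pi.div_apply, div_eq_iff hN, Finset.prod_mul_distrib, Finset.prod_mul_distrib,
      mul_right_comm (∏ i ∈ Finset.range N, (1 - Complex.exp x * q ^ i)),
      ← Finset.prod_range_succ, Finset.prod_range_succ', pow_zero, mul_one]
    ring
  -- The coefficients are extended by zero to all of ℤ so that dominated convergence applies.
  have lim2 : Tendsto (fun N : ℕ => ∑' l : ℤ, (if l ∈ Finset.Icc (-(N : ℤ)) N then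
      gaussBinom q (2 * N) (N + l).toNat else 0) * G l) atTop
      (𝓝 (∑' l : ℤ, (qPochInf q)⁻¹ * G l)) := by
    obtain ⟨C, hC⟩ := exists_norm_gaussBinom_le hq
    refine tendsto_tsum_of_dominated_convergence
      ((summable_norm_gaussTerm hL2 (x + Real.pi * Complex.I - L / 2)).mul_left C) ?_ ?_
    · intro l
      refine Tendsto.mul_const _ ((tendsto_gaussBinom hq l).congr' ?_)
      filter_upwards [eventually_ge_atTop l.natAbs] with N hN
      rw [if_pos (Finset.mem_Icc.mpr (by omega))]
    · refine Eventually.of_forall fun N l => ?_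
      rw [norm_mul]
      refine mul_le_mul_of_nonneg_right ?_ (norm_nonneg _)
      split_ifs
      · exact hC _ _
      · rw [norm_zero]; exact (norm_nonneg _).trans (hC 0 0)
  rw [tsum_mul_left] at lim2
  refine tendsto_nhds_unique lim1 (lim2.congr fun N => ?_)
  rw [finite_triple_product hL hq, tsum_eq_sum (s := Finset.Icc (-(N : ℤ)) N)
    (fun l hl => by rw [if_neg hl, zero_mul])]
  symm
  refine Finset.sum_bij (fun (j : ℕ) _ => (j : ℤ) - N) ?_ ?_ ?_ ?_
  · intro j hj
    have := Finset.mem_range.mp hj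
    exact Finset.mem_Icc.mpr (by omega)
  · intro i _ j _ h
    omega
  · intro l hl
    have := Finset.mem_Icc.mp hl
    exact ⟨(N + l).toNat, Finset.mem_range.mpr (by omega), by omega⟩
  · intro j hj
    have := Finset.mem_range.mp hj
    rw [if_pos (Finset.mem_Icc.mpr (by omega))]
    congr 2
    omega

/-! ### Theta as a Gaussian sum, and the Weierstrass identity -/

lemma theta_eq_gaussSum {q L : ℂ} (hL : Complex.exp L = q) (hq : ‖q‖ < 1) (x : ℂ) :
    theta q x = -(qPochInf q)⁻¹ * (Complex.exp (-(x / 2)) *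
      gaussSum (L / 2) (x + Real.pi * Complex.I - L / 2)) := by
  have h : Complex.exp (x / 2) - Complex.exp (-(x / 2)) =
      -Complex.exp (-(x / 2)) * (1 - Complex.exp x) := by
    have : Complex.exp (x / 2) = Complex.exp (-(x / 2)) * Complex.exp x := by
      rw [← Complex.exp_add]; congr 1; ring
    rw [this]; ring
  rw [theta, h, mul_assoc, triple_product hL hq]
  ring

lemma theta_neg (q x : ℂ) : theta q (-x) = -theta q x := by
  have : ∀ k : ℕ, (1 - Complex.exp (-x) * q ^ (k + 1)) * (1 - Complex.exp x * q ^ (k + 1)) =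
    (1 - Complex.exp x * q ^ (k + 1)) * (1 - Complex.exp (-x) * q ^ (k + 1)) :=
    fun k => mul_comm _ _
  simp only [theta, neg_neg, neg_div, this]
  ring

/-- The Weierstrass three-term identity. -/
theorem theta_three_term {q : ℂ} (h0 : 0 < ‖q‖) (hq : ‖q‖ < 1) (x y z w : ℂ) :
    theta q (x + y) * theta q (x - y) * (theta q (z + w) * theta q (z - w)) -
      theta q (x + z) * theta q (x - z) * (theta q (y + w) * theta q (y - w)) +
      theta q (x + w) * theta q (x - w) * (theta q (y + z) * theta q (y - z)) = 0 := by
  have hL := Complex.exp_log (norm_pos_iff.mp h0)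
  set L := Complex.log q
  -- Each product is a determinant of the vectors (`oddSum`, `evenSum`) at a and b; the claim
  -- becomes the Plücker relation, which `ring` verifies.
  have key : ∀ a b : ℂ, theta q (a + b) * theta q (a - b) = (qPochInf q)⁻¹ ^ 2 *
      (oddSum L a * evenSum L b - evenSum L a * oddSum L b) := fun a b => by
    rw [← gaussSum_mul_gaussSum (re_log_neg hL hq), theta_eq_gaussSum hL hq,
      theta_eq_gaussSum hL hq]
    have : Complex.exp (-a) = Complex.exp (-((a + b) / 2)) * Complex.exp (-((a - b) / 2)) := by
      rw [← Complex.exp_add]; congr 1; ring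
    rw [this]
    ring
  simp only [key]
  ring

section

/-! ### The scalar identities behind the Yang–Baxter equation -/

/-- Odd functions subject to the Weierstrass three-term identity. -/
structure IsSigmaLike (f : ℂ → ℂ) : Prop where
  odd : ∀ x, f (-x) = -f x
  three_term : ∀ x y z w : ℂ,
    f (x + y) * f (x - y) * (f (z + w) * f (z - w)) -
      f (x + z) * f (x - z) * (f (y + w) * f (y - w)) +
      f (x + w) * f (x - w) * (f (y + z) * f (y - z)) = 0

lemma isSigmaLike_theta {q : ℂ} (h0 : 0 < ‖q‖) (hq : ‖q‖ < 1) : IsSigmaLike (theta q) :=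
  ⟨theta_neg q, theta_three_term h0 hq⟩

/-- The numerator of the exchange amplitude. -/
def exch (f : ℂ → ℂ) (h u x : ℂ) : ℂ := -(f h * f (u + x) / f x)

/-- The product of the two normalized transmission amplitudes. -/
def trans2 (f : ℂ → ℂ) (h x : ℂ) : ℂ := f (x + h) * f (x - h) / f x ^ 2

lemma trans2_neg_left (f : ℂ → ℂ) (h x : ℂ) : trans2 f (-h) x = trans2 f h x := by
  rw [trans2, trans2, sub_neg_eq_add, ← sub_eq_add_neg, mul_comm (f (x - h))]

lemma exch_eq_zero {f : ℂ → ℂ} {h : ℂ} (hh : f h = 0) (u x : ℂ) : exch f h u x = 0 := by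
  rw [exch, hh]; simp

namespace IsSigmaLike

variable {f : ℂ → ℂ} (hf : IsSigmaLike f)
include hf

lemma zero : f 0 = 0 := by
  have := hf.odd 0
  rw [neg_zero] at this
  exact self_eq_neg.mp this

lemma exch_neg_self {h : ℂ} (hh : f h ≠ 0) (u : ℂ) : exch f h u (-h) = f (u - h) := by
  rw [exch, hf.odd, ← sub_eq_add_neg]
  field_simp

lemma trans2_neg (h x : ℂ) : trans2 f h (-x) = trans2 f h x := by
  rw [trans2, trans2, hf.odd, show -x + h = -(x - h) by ring, show -x - h = -(x + h) by ring,
    hf.odd, hf.odd]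
  ring

lemma trans2_self (h : ℂ) : trans2 f h h = 0 := by
  rw [trans2, sub_self, hf.zero]; simp

/-- The analogue of the sigma-function factorisation of ℘(x) − ℘(y), from the three-term identity
with one argument 0. -/
lemma trans2_sub {x y : ℂ} (hx : f x ≠ 0) (hy : f y ≠ 0) (h : ℂ) :
    trans2 f h y - trans2 f h x = f h ^ 2 * (f (x + y) * f (y - x) / (f x ^ 2 * f y ^ 2)) := by
  have := hf.three_term y h x 0
  simp only [add_zero, sub_zero, show h - x = -(x - h) by ring, hf.odd,
    add_comm h x, add_comm y x] at this
  rw [trans2, trans2]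
  field_simp
  linear_combination this

lemma exch_three {h u w x y : ℂ} (hx : f x ≠ 0) (hy : f y ≠ 0) (hxy : f (x + y) ≠ 0) :
    f w * exch f h (u + w) (x + y) * exch f h u (-y) + exch f h w y * exch f h (u + w) x * f u =
      exch f h u x * f (u + w) * exch f h w (x + y) := by
  -- The half-sums are chosen so that their pairwise sums and differences are exactly the arguments
  -- met after clearing denominators.
  have := hf.three_term ((u + 2 * w + x + y) / 2) ((u + x + y) / 2) ((x + u - y) / 2)
    ((x - u + y) / 2)
  ring_nf at this
  simp only [exch, hf.odd]
  field_simp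
  ring_nf
  linear_combination -f h ^ 2 * this

/-- Two uses of the three-term identity: `trans2_sub` merges the two transmission terms into one
product, and a second instance cancels this against the two triple exchange products. -/
lemma exch_cubic {h u w x y : ℂ} (hx : f x ≠ 0) (hy : f y ≠ 0) (hxy : f (x + y) ≠ 0) :
    f w * f u * exch f h (u + w) (x + y) * trans2 f h y +
        exch f h w y * exch f h (u + w) x * exch f h u y =
      f w * f u * exch f h (u + w) (x + y) * trans2 f h x +
        exch f h u x * exch f h (u + w) y * exch f h w x := by
  have h1 := hf.trans2_sub hx hy h
  have h2 := hf.three_term ((u + w) / 2 + y) ((u + w) / 2 + x) ((u + w) / 2) ((u - w) / 2)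
  have h3 : exch f h (u + w) (x + y) * f (x + y) = -(f h * f (u + w + (x + y))) := by
    rw [exch]; field_simp
  have h4 : f w * f u * exch f h (u + w) (x + y) * (trans2 f h y - trans2 f h x) =
      -(f h ^ 3 * (f w * f u * f (u + w + (x + y)) * f (y - x)) / (f x ^ 2 * f y ^ 2)) := by
    rw [h1]
    field_simp
    linear_combination h3 * f w * f u * f (y - x) * f h ^ 2
  rw [← sub_eq_zero]
  have h5 : exch f h w y * exch f h (u + w) x * exch f h u y -
      exch f h u x * exch f h (u + w) y * exch f h w x =
      -(f h ^ 3 * (f (w + y) * f (u + w + x) * f (u + y) * f x -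
        f (u + x) * f (u + w + y) * f (w + x) * f y) / (f x ^ 2 * f y ^ 2)) := by
    simp only [exch]
    field_simp
    ring
  have h6 : f w * f u * f (u + w + (x + y)) * f (y - x) +
      (f (w + y) * f (u + w + x) * f (u + y) * f x -
        f (u + x) * f (u + w + y) * f (w + x) * f y) = 0 := by
    ring_nf at h2 ⊢
    linear_combination h2
  have h7 : -(f h ^ 3 * (f w * f u * f (u + w + (x + y)) * f (y - x)) / (f x ^ 2 * f y ^ 2)) +
      -(f h ^ 3 * (f (w + y) * f (u + w + x) * f (u + y) * f x -
        f (u + x) * f (u + w + y) * f (w + x) * f y) / (f x ^ 2 * f y ^ 2)) = 0 := by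
    rw [← neg_add, ← add_div, ← mul_add, h6]
    simp
  linear_combination h7 + h4 + h5

lemma exch_neg_left (h u x : ℂ) : exch f (-h) u x = -exch f h u x := by
  rw [exch, exch, hf.odd]
  ring

/-! The degenerations of `exch_three` and `exch_cubic` with a repeated label. The sign `σ`
distinguishes even (`σ = 1`) and odd (`σ = -1`) repeated labels. -/

/-- Take one difference equal to −h, where the exchange amplitude becomes f(u−h). This needs f h ≠
0; otherwise every term has a vanishing exchange factor. The odd sign follows by h ↦ −h, since
`exch` is odd in h. -/
lemma exch_three_rep {σ h u w x : ℂ} (hσ : σ = 1 ∨ σ = -1) (hx : f x ≠ 0)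
    (hx' : f (x - σ * h) ≠ 0) :
    f w * exch f h (u + w) (x - σ * h) * exch f h u (-x) +
        exch f h w x * (σ * f (u + w - σ * h)) * f u =
      (σ * f (u - σ * h)) * f (u + w) * exch f h w (x - σ * h) := by
  have key : ∀ h : ℂ, f (x - h) ≠ 0 → f w * exch f h (u + w) (x - h) * exch f h u (-x) +
      exch f h w x * f (u + w - h) * f u = f (u - h) * f (u + w) * exch f h w (x - h) := by
    intro h hx'
    by_cases hh : f h = 0
    · simp [exch_eq_zero hh]
    · have := hf.exch_three (h := h) (u := u) (w := w) (x := -h) (y := x)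
        (by rwa [hf.odd, neg_ne_zero]) hx (by rwa [neg_add_eq_sub])
      rwa [hf.exch_neg_self hh, hf.exch_neg_self hh, neg_add_eq_sub] at this
  rcases hσ with rfl | rfl
  · simp only [one_mul] at hx' ⊢
    exact key h hx'
  · have := key (-h)
    simp only [hf.exch_neg_left, neg_one_mul] at this hx' ⊢
    linear_combination this hx'

/-- The same specialisation of `exch_cubic`; one transmission term drops out because `trans2`
vanishes at −h. -/
lemma exch_quad_rep {σ h u w x : ℂ} (hσ : σ = 1 ∨ σ = -1) (hx : f x ≠ 0)
    (hx' : f (x - σ * h) ≠ 0) :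
    f w * f u * exch f h (u + w) (x - σ * h) * trans2 f h x +
        exch f h w x * exch f h u x * (σ * f (u + w - σ * h)) =
      (σ * f (u - σ * h)) * (σ * f (w - σ * h)) * exch f h (u + w) x := by
  have key : ∀ h : ℂ, f (x - h) ≠ 0 → f w * f u * exch f h (u + w) (x - h) * trans2 f h x +
      exch f h w x * exch f h u x * f (u + w - h) =
      f (u - h) * f (w - h) * exch f h (u + w) x := by
    intro h hx'
    by_cases hh : f h = 0
    · simp [exch_eq_zero hh]
    · have := hf.exch_cubic (h := h) (u := u) (w := w) (x := -h) (y := x)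
        (by rwa [hf.odd, neg_ne_zero]) hx (by rwa [neg_add_eq_sub])
      rw [hf.exch_neg_self hh, hf.exch_neg_self hh, hf.exch_neg_self hh, neg_add_eq_sub,
        hf.trans2_neg, hf.trans2_self] at this
      linear_combination this
  rcases hσ with rfl | rfl
  · simp only [one_mul] at hx' ⊢
    exact key h hx'
  · have := key (-h)
    simp only [hf.exch_neg_left, neg_one_mul, trans2_neg_left] at this hx' ⊢
    linear_combination -this hx'

/-- Now the two differences x − h and −x add up to −h, so the amplitude of their sum is the one that
becomes diagonal. -/
lemma exch_cubic_rep {σ h u w x : ℂ} (hσ : σ = 1 ∨ σ = -1) (hx : f x ≠ 0)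
    (hx' : f (x - σ * h) ≠ 0) :
    f w * f u * (σ * f (u + w - σ * h)) * trans2 f h x +
        exch f h w (-x) * exch f h (u + w) (x - σ * h) * exch f h u (-x) =
      f w * f u * (σ * f (u + w - σ * h)) * trans2 f h (x - σ * h) +
        exch f h u (x - σ * h) * exch f h (u + w) (-x) * exch f h w (x - σ * h) := by
  have key : ∀ h : ℂ, f (x - h) ≠ 0 → f w * f u * f (u + w - h) * trans2 f h x +
        exch f h w (-x) * exch f h (u + w) (x - h) * exch f h u (-x) =
      f w * f u * f (u + w - h) * trans2 f h (x - h) +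
        exch f h u (x - h) * exch f h (u + w) (-x) * exch f h w (x - h) := by
    intro h hx'
    by_cases hh : f h = 0
    -- Without exchange terms only equality of the two `trans2` values is left; their difference
    -- carries a factor f(h)².
    · have := hf.trans2_sub hx' hx h
      simp only [exch_eq_zero hh]
      rw [hh] at this
      linear_combination f w * f u * f (u + w - h) * this
    · have e : x - h + -x = -h := by ring
      have := hf.exch_cubic (h := h) (u := u) (w := w) (x := x - h) (y := -x) hx'
        (by rwa [hf.odd, neg_ne_zero]) (by rwa [e, hf.odd, neg_ne_zero])
      rwa [e, hf.exch_neg_self hh, hf.trans2_neg] at this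
  rcases hσ with rfl | rfl
  · simp only [one_mul] at hx' ⊢
    exact key h hx'
  · have := key (-h)
    simp only [hf.exch_neg_left, neg_one_mul, trans2_neg_left] at this hx' ⊢
    linear_combination -this hx'

end IsSigmaLike

end

section

/-! ### The Yang–Baxter equation for operators with polynomial entries -/

/-- The vector `v_α ⊗ v_β ⊗ v_γ`. -/
def tens3 {n : ℕ} (α β γ : Idx n) : Idx n × Idx n × Idx n → ℂ := Pi.single (α, β, γ) 1

/-- The weight-preserving operator with amplitudes `d`, `a`, `b`. -/
def weightOp {n : ℕ} (d : Idx n → ℂ) (a b : Idx n → Idx n → ℂ) : Op2 n :=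
  Matrix.of fun p s => (if s.1 = s.2 then d s.1 • tens s.1 s.2
    else a s.1 s.2 • tens s.1 s.2 + b s.1 s.2 • tens s.2 s.1) p

variable {n : ℕ} (d : Idx n → Idx n → ℂ) (a b : Idx n → Idx n → Idx n → ℂ) (α β γ : Idx n)

lemma leg12_mulVec : (leg12 fun c => weightOp (d c) (a c) (b c)).mulVec (tens3 α β γ) =
    if α = β then d γ α • tens3 α β γ else a γ α β • tens3 α β γ + b γ α β • tens3 β α γ := by
  ext ⟨i, j, k⟩
  rw [tens3, Matrix.mulVec_single_one]
  by_cases h : α = β <;> by_cases hk : k = γ <;>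
    simp [leg12, weightOp, tens, tens3, Pi.single_apply, h, hk]

lemma leg13_mulVec : (leg13 fun c => weightOp (d c) (a c) (b c)).mulVec (tens3 α β γ) =
    if α = γ then d β α • tens3 α β γ else a β α γ • tens3 α β γ + b β α γ • tens3 γ β α := by
  ext ⟨i, j, k⟩
  rw [tens3, Matrix.mulVec_single_one]
  by_cases h : α = γ <;> by_cases hk : j = β <;>
    simp [leg13, weightOp, tens, tens3, Pi.single_apply, h, hk]

lemma leg23_mulVec : (leg23 fun c => weightOp (d c) (a c) (b c)).mulVec (tens3 α β γ) =
    if β = γ then d α β • tens3 α β γ else a α β γ • tens3 α β γ + b α β γ • tens3 α γ β := by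
  ext ⟨i, j, k⟩
  rw [tens3, Matrix.mulVec_single_one]
  by_cases h : β = γ <;> by_cases hk : i = α <;>
    simp [leg23, weightOp, tens, tens3, Pi.single_apply, h, hk]

/-- The sign `(-1)^{|v_α|}`. -/
def parSign {n : ℕ} (α : Idx n) : ℂ := if α = Fin.last n then -1 else 1

lemma parSign_eq (α : Idx n) : parSign α = 1 ∨ parSign α = -1 := by
  rw [parSign]; split_ifs <;> simp

/-- The amplitude of a repeated label. -/
def diagAmp (f : ℂ → ℂ) (h u : ℂ) (α : Idx n) : ℂ := parSign α * f (u - parSign α * h)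

/-- The transmission amplitude of distinct labels, up to a common factor. -/
def transGauge (f : ℂ → ℂ) (h : ℂ) (ξ : Idx n → ℂ) (α β : Idx n) : ℂ :=
  if α < β then 1 else trans2 f h (ξ β - ξ α)

/-- The exchange amplitude of distinct labels. -/
def exchAmp (f : ℂ → ℂ) (h u : ℂ) (ξ : Idx n → ℂ) (α β : Idx n) : ℂ :=
  exch f h u (ξ β - ξ α)

/-- The numerator of the elliptic dynamical R-matrix as a function of potentials `ξ` of the
dynamical variables. -/
def numOp (f : ℂ → ℂ) (h u : ℂ) (ξ : Idx n → ℂ) : Op2 n :=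
  weightOp (diagAmp f h u) (fun α β => f u * transGauge f h ξ α β) (exchAmp f h u ξ)

/-- The shift of the potentials by the weight of `v_γ`. -/
def potShift (h : ℂ) (ξ : Idx n → ℂ) (γ : Idx n) : Idx n → ℂ :=
  ξ + Pi.single γ (parSign γ * h)

variable {α β γ} {f : ℂ → ℂ} {h u w : ℂ} {ξ : Idx n → ℂ}

lemma potShift_self : potShift h ξ γ γ = ξ γ + parSign γ * h := by
  simp [potShift]

lemma potShift_of_ne (hα : α ≠ γ) : potShift h ξ γ α = ξ α := by
  simp [potShift, hα]

/-- This makes the asymmetric choice of transmission amplitudes harmless: the cubic and quadratic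
relations see only the product, and elsewhere a single amplitude is a common factor. -/
lemma transGauge_mul (hf : IsSigmaLike f) (hαβ : α ≠ β) :
    transGauge f h ξ α β * transGauge f h ξ β α = trans2 f h (ξ β - ξ α) := by
  rcases lt_or_gt_of_ne hαβ with h1 | h1
  · rw [transGauge, transGauge, if_pos h1, if_neg h1.not_gt, one_mul, ← neg_sub, hf.trans2_neg]
  · rw [transGauge, transGauge, if_pos h1, if_neg h1.not_gt, mul_one]

lemma transGauge_potShift (hα : α ≠ γ) (hβ : β ≠ γ) :
    transGauge f h (potShift h ξ γ) α β = transGauge f h ξ α β := by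
  rw [transGauge, transGauge, potShift_of_ne hα, potShift_of_ne hβ]

lemma exchAmp_potShift (hα : α ≠ γ) (hβ : β ≠ γ) :
    exchAmp f h u (potShift h ξ γ) α β = exchAmp f h u ξ α β := by
  rw [exchAmp, exchAmp, potShift_of_ne hα, potShift_of_ne hβ]

/-- The dynamical variables avoid the zeros of `f`, before and after each shift. -/
structure PotRegular (f : ℂ → ℂ) (h : ℂ) (ξ : Idx n → ℂ) : Prop where
  ne_zero : ∀ α β, α ≠ β → f (ξ β - ξ α) ≠ 0
  shift_ne_zero : ∀ α β, α ≠ β → f (ξ β - ξ α - parSign α * h) ≠ 0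

section Relations

variable (hf : IsSigmaLike f) (hξ : PotRegular f h ξ)
include hf hξ

lemma exchAmp_three (u w : ℂ) (h1 : α ≠ β) (h2 : β ≠ γ) (h3 : α ≠ γ) :
    f w * exchAmp f h (u + w) ξ α γ * exchAmp f h u ξ γ β +
      exchAmp f h w ξ β γ * exchAmp f h (u + w) ξ α β * f u =
    exchAmp f h u ξ α β * f (u + w) * exchAmp f h w ξ α γ := by
  have := hf.exch_three (h := h) (u := u) (w := w) (hξ.ne_zero _ _ h1) (hξ.ne_zero _ _ h2)
    (by rw [add_comm, sub_add_sub_cancel]; exact hξ.ne_zero _ _ h3)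
  rwa [add_comm (ξ β - ξ α), sub_add_sub_cancel, neg_sub] at this

lemma exchAmp_three' (u w : ℂ) (h1 : α ≠ β) (h2 : β ≠ γ) (h3 : α ≠ γ) :
    f u * exchAmp f h (u + w) ξ α γ * exchAmp f h w ξ β α +
      exchAmp f h u ξ α β * exchAmp f h (u + w) ξ β γ * f w =
    exchAmp f h w ξ β γ * f (u + w) * exchAmp f h u ξ α γ := by
  have := hf.exch_three (h := h) (u := w) (w := u) (hξ.ne_zero _ _ h2) (hξ.ne_zero _ _ h1)
    (by rw [sub_add_sub_cancel]; exact hξ.ne_zero _ _ h3)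
  rwa [sub_add_sub_cancel, neg_sub, add_comm w u] at this

lemma exchAmp_cubic (u w : ℂ) (h1 : α ≠ β) (h2 : β ≠ γ) (h3 : α ≠ γ) :
    f w * f u * exchAmp f h (u + w) ξ α γ * (transGauge f h ξ β γ * transGauge f h ξ γ β) +
      exchAmp f h w ξ β γ * exchAmp f h (u + w) ξ α β * exchAmp f h u ξ β γ =
    f w * f u * exchAmp f h (u + w) ξ α γ * (transGauge f h ξ α β * transGauge f h ξ β α) +
      exchAmp f h u ξ α β * exchAmp f h (u + w) ξ β γ * exchAmp f h w ξ α β := by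
  have := hf.exch_cubic (h := h) (u := u) (w := w) (hξ.ne_zero _ _ h1) (hξ.ne_zero _ _ h2)
    (by rw [add_comm, sub_add_sub_cancel]; exact hξ.ne_zero _ _ h3)
  rwa [add_comm (ξ β - ξ α), sub_add_sub_cancel, ← transGauge_mul hf h1,
    ← transGauge_mul hf h2] at this

omit hf hξ in
lemma exchAmp_potShift_left (u : ℂ) (h1 : β ≠ α) :
    exchAmp f h u (potShift h ξ α) α β = exch f h u (ξ β - ξ α - parSign α * h) := by
  rw [exchAmp, potShift_self, potShift_of_ne h1, sub_add_eq_sub_sub]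

omit hf hξ in
lemma exchAmp_potShift_right (u : ℂ) (h1 : β ≠ α) :
    exchAmp f h u (potShift h ξ α) β α = exch f h u (-(ξ β - ξ α - parSign α * h)) := by
  rw [exchAmp, potShift_self, potShift_of_ne h1]
  congr 1
  ring

lemma exchAmp_three_rep (u w : ℂ) (h1 : α ≠ β) :
    f w * exchAmp f h (u + w) (potShift h ξ α) α β * exchAmp f h u ξ β α +
      exchAmp f h w ξ α β * diagAmp f h (u + w) α * f u =
    diagAmp f h u α * f (u + w) * exchAmp f h w (potShift h ξ α) α β := by
  have := hf.exch_three_rep (u := u) (w := w) (parSign_eq α) (hξ.ne_zero _ _ h1)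
    (hξ.shift_ne_zero _ _ h1)
  rwa [← exchAmp_potShift_left _ h1.symm, ← exchAmp_potShift_left _ h1.symm, neg_sub] at this

/-- For x = −(ξ_β − ξ_α − σħ) one has x − σħ = ξ_α − ξ_β, so shifted and unshifted potentials
exchange roles in the scalar identity. -/
lemma exchAmp_three_rep' (u w : ℂ) (h1 : α ≠ β) :
    f w * exchAmp f h (u + w) ξ β α * exchAmp f h u (potShift h ξ α) α β +
      exchAmp f h w (potShift h ξ α) β α * diagAmp f h (u + w) α * f u =
    diagAmp f h u α * f (u + w) * exchAmp f h w ξ β α := by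
  have e : -(ξ β - ξ α - parSign α * h) - parSign α * h = ξ α - ξ β := by ring
  have := hf.exch_three_rep (u := u) (w := w) (x := -(ξ β - ξ α - parSign α * h)) (parSign_eq α)
    (by rw [hf.odd, neg_ne_zero]; exact hξ.shift_ne_zero _ _ h1)
    (by rw [e]; exact hξ.ne_zero _ _ h1.symm)
  rwa [← exchAmp_potShift_right _ h1.symm, e, neg_neg, ← exchAmp_potShift_left _ h1.symm] at this

lemma exchAmp_quad_rep (u w : ℂ) (h1 : α ≠ β) :
    f w * f u * exchAmp f h (u + w) (potShift h ξ α) α β *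
        (transGauge f h ξ α β * transGauge f h ξ β α) +
      exchAmp f h w ξ α β * exchAmp f h u ξ α β * diagAmp f h (u + w) α =
    diagAmp f h u α * diagAmp f h w α * exchAmp f h (u + w) ξ α β := by
  have := hf.exch_quad_rep (u := u) (w := w) (parSign_eq α) (hξ.ne_zero _ _ h1)
    (hξ.shift_ne_zero _ _ h1)
  rwa [← exchAmp_potShift_left _ h1.symm, ← transGauge_mul hf h1] at this

lemma exchAmp_quad_rep' (u w : ℂ) (h1 : α ≠ β) :
    f w * f u * exchAmp f h (u + w) ξ β α *
        (transGauge f h (potShift h ξ α) α β * transGauge f h (potShift h ξ α) β α) +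
      exchAmp f h w (potShift h ξ α) β α * exchAmp f h u (potShift h ξ α) β α *
        diagAmp f h (u + w) α =
    diagAmp f h u α * diagAmp f h w α * exchAmp f h (u + w) (potShift h ξ α) β α := by
  have e : -(ξ β - ξ α - parSign α * h) - parSign α * h = ξ α - ξ β := by ring
  have := hf.exch_quad_rep (u := u) (w := w) (x := -(ξ β - ξ α - parSign α * h)) (parSign_eq α)
    (by rw [hf.odd, neg_ne_zero]; exact hξ.shift_ne_zero _ _ h1)
    (by rw [e]; exact hξ.ne_zero _ _ h1.symm)
  rw [← exchAmp_potShift_right _ h1.symm, ← exchAmp_potShift_right _ h1.symm,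
    ← exchAmp_potShift_right _ h1.symm, e] at this
  rw [transGauge_mul hf h1, potShift_self, potShift_of_ne h1.symm, sub_add_eq_sub_sub,
    ← hf.trans2_neg]
  exact this

lemma exchAmp_cubic_rep (u w : ℂ) (h1 : α ≠ β) :
    f w * f u * diagAmp f h (u + w) α * (transGauge f h ξ α β * transGauge f h ξ β α) +
      exchAmp f h w ξ β α * exchAmp f h (u + w) (potShift h ξ α) α β * exchAmp f h u ξ β α =
    f w * f u * diagAmp f h (u + w) α *
        (transGauge f h (potShift h ξ α) α β * transGauge f h (potShift h ξ α) β α) +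
      exchAmp f h u (potShift h ξ α) α β * exchAmp f h (u + w) ξ β α *
        exchAmp f h w (potShift h ξ α) α β := by
  have := hf.exch_cubic_rep (u := u) (w := w) (parSign_eq α) (hξ.ne_zero _ _ h1)
    (hξ.shift_ne_zero _ _ h1)
  rw [neg_sub, ← exchAmp_potShift_left _ h1.symm, ← exchAmp_potShift_left _ h1.symm,
    ← exchAmp_potShift_left _ h1.symm] at this
  rw [transGauge_mul hf h1, transGauge_mul hf h1, potShift_self, potShift_of_ne h1.symm,
    sub_add_eq_sub_sub]
  exact this

end Relations

/-- Both sides are compared on basis vectors, one case per coincidence pattern of the three labels.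
Each relation invoked is the coefficient of one output vector; the outputs not listed agree
identically. -/
theorem numOp_yangBaxter (hf : IsSigmaLike f) (hξ : PotRegular f h ξ) :
    leg12 (fun _ => numOp f h u ξ) * leg13 (fun γ => numOp f h (u + w) (potShift h ξ γ)) *
        leg23 (fun _ => numOp f h w ξ) =
      leg23 (fun γ => numOp f h w (potShift h ξ γ)) * leg13 (fun _ => numOp f h (u + w) ξ) *
        leg12 (fun γ => numOp f h u (potShift h ξ γ)) := by
  refine Matrix.ext_of_mulVec_single fun i => ?_
  obtain ⟨α, β, γ⟩ := i
  change Matrix.mulVec _ (tens3 α β γ) = Matrix.mulVec _ (tens3 α β γ)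
  simp only [← Matrix.mulVec_mulVec, numOp]
  by_cases h1 : α = β <;> by_cases h2 : β = γ
  · subst h1 h2
    simp only [leg12_mulVec, leg13_mulVec, leg23_mulVec, Matrix.mulVec_smul, if_true]
    module
  · subst h1
    have h2' := Ne.symm h2
    simp only [leg12_mulVec, leg13_mulVec, leg23_mulVec, Matrix.mulVec_smul, Matrix.mulVec_add,
      if_true, h2, h2', if_false]
    linear_combination (norm := module)
      (transGauge f h ξ α γ * exchAmp_three_rep hf hξ u w h2) • tens3 α γ α +
      exchAmp_quad_rep hf hξ u w h2 • tens3 γ α α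
  · subst h2
    have h2' := Ne.symm h1
    simp only [leg12_mulVec, leg13_mulVec, leg23_mulVec, Matrix.mulVec_smul, Matrix.mulVec_add,
      if_true, h1, h2', if_false]
    have k := exchAmp_three_rep' hf hξ w u h2'
    rw [add_comm w u] at k
    linear_combination (norm := module)
      (-transGauge f h (potShift h ξ β) α β * k) • tens3 β α β -
      exchAmp_quad_rep' hf hξ u w h2' • tens3 β β α
  · by_cases h3 : α = γ
    · subst h3
      simp only [leg12_mulVec, leg13_mulVec, leg23_mulVec, Matrix.mulVec_smul, Matrix.mulVec_add,
        if_true, h1, h2, if_false]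
      have k := exchAmp_three_rep hf hξ w u h1
      rw [add_comm w u] at k
      linear_combination (norm := module)
        exchAmp_cubic_rep hf hξ u w h1 • tens3 α β α +
        (transGauge f h ξ β α * k) • tens3 β α α -
        (transGauge f h (potShift h ξ α) α β * exchAmp_three_rep' hf hξ u w h1) • tens3 α α β
    · have h1' := Ne.symm h1
      have h2' := Ne.symm h2
      have h3' := Ne.symm h3
      simp only [leg12_mulVec, leg13_mulVec, leg23_mulVec, Matrix.mulVec_smul, Matrix.mulVec_add,
        h1, h2, h3, h1', h2', h3', if_false, transGauge_potShift, exchAmp_potShift, ne_eq,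
        not_false_eq_true]
      linear_combination (norm := module)
        exchAmp_cubic hf hξ u w h1 h2 h3 • tens3 γ β α +
        (transGauge f h ξ β γ * exchAmp_three hf hξ u w h1 h2 h3) • tens3 β γ α -
        (transGauge f h ξ α β * exchAmp_three' hf hξ u w h1 h2 h3) • tens3 γ α β

end

/-! ### The dynamical shifts -/

lemma sum_fin_ite_val_eq {M : Type*} [AddCommMonoid M] {n : ℕ} (k : ℕ) (x : M) :
    (∑ j : Fin n, if j.val = k then x else 0) = if k < n then x else 0 := by
  split_ifs with hk
  · rw [Finset.sum_eq_single ⟨k, hk⟩]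
    · simp
    · intro j _ hj
      exact if_neg fun h => hj (Fin.ext h)
    · simp
  · refine Finset.sum_eq_zero fun j _ => if_neg ?_
    have := j.isLt
    omega

lemma cartanMatrix_mulVec_gaugeDim {n : ℕ} (α : Idx n) (i : Fin n) :
    (cartanMatrix n).mulVec (gaugeDim α) i =
      (if i.val < α.val then 2 * (1 - if i.val + 1 = n then 1 else 0) else 0) -
        (if i.val + 1 < α.val then 1 else 0) - (if 0 < i.val ∧ i.val ≤ α.val then 1 else 0) := by
  have hα := α.isLt
  have hi := i.isLt
  have e : ∀ j : Fin n, cartanMatrix n i j * gaugeDim α j =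
      (if j.val = i.val then (if i.val < α.val then 2 * (1 - if i.val + 1 = n then 1 else 0) else 0)
        else 0) - (if j.val = i.val + 1 then (if i.val + 1 < α.val then 1 else 0) else 0) -
        (if j.val = i.val - 1 then (if 0 < i.val ∧ i.val ≤ α.val then 1 else 0) else 0) := by
    intro j
    simp only [cartanMatrix, gaugeDim, Matrix.of_apply, Fin.ext_iff, sub_mul]
    congr 1
    · congr 1
      · by_cases h1 : i.val = j.val
        · simp [h1]
        · simp [h1, Ne.symm h1]
      · by_cases h1 : i.val + 1 = j.val
        · simp [h1]
        · simp [h1, Ne.symm h1]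
    · by_cases h1 : i.val = j.val + 1
      · simp [h1]
      · rw [if_neg h1, zero_mul]
        split_ifs <;> omega
  simp only [Matrix.mulVec, dotProduct, e, Finset.sum_sub_distrib, sum_fin_ite_val_eq]
  split_ifs <;> omega

/-- One formula serves all labels, since at α = 0 and α = n the missing node is simply not in `Fin
n`. -/
lemma mu_eq {n : ℕ} (α : Idx n) (i : Fin n) :
    mu α i = (if i.val = α.val then 1 else 0) -
      (if α = Fin.last n then -1 else 1) * (if i.val + 1 = α.val then 1 else 0) := by
  have hα := α.isLt
  have hi := i.isLt
  rw [mu, Pi.sub_apply, cartanMatrix_mulVec_gaugeDim, framingDim]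
  simp only [Fin.ext_iff, Fin.val_last]
  split_ifs <;> omega

theorem mu_explicit {n : ℕ} (α : Idx n) (i : Fin n) :
    (α.val = 0 → mu α i = if i.val + 1 = 1 then 1 else 0) ∧
    (0 < α.val → α.val < n → mu α i =
      if i.val + 1 = α.val then -1 else if i.val + 1 = α.val + 1 then 1 else 0) ∧
    (α.val = n → mu α i = if i.val + 1 = n then 1 else 0) := by
  have hα := α.isLt
  have hi := i.isLt
  rw [mu_eq]
  simp only [Fin.ext_iff, Fin.val_last]
  refine ⟨fun h => ?_, fun h h' => ?_, fun h => ?_⟩ <;> split_ifs <;> omega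

/-! ### The R-matrix in terms of potentials -/

/-- The potentials of the dynamical variables. -/
def pot {n : ℕ} (h : ℂ) (z : Fin n → ℂ) (α : Idx n) : ℂ :=
  (∑ j : Fin n, if j.castSucc < α then z j else 0) - hdelta h α

lemma pot_sub_pot {n : ℕ} (h : ℂ) (z : Fin n → ℂ) {α β : Idx n} (hαβ : α < β) :
    pot h z β - pot h z α = zsum z α β - hdelta h β := by
  have hα : hdelta h α = 0 := if_neg (hαβ.trans_le (Fin.le_last β)).ne
  have : zsum z α β = (∑ j : Fin n, if j.castSucc < β then z j else 0) -
      ∑ j : Fin n, if j.castSucc < α then z j else 0 := by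
    rw [zsum, ← Finset.sum_sub_distrib]
    refine Finset.sum_congr rfl fun j _ => ?_
    by_cases h1 : j.castSucc < α
    · rw [if_pos h1, if_pos (h1.trans hαβ), if_neg fun h => h1.not_ge h.1, sub_self]
    · simp [h1, not_lt.mp h1]
  rw [pot, pot, this, hα]
  ring

lemma exists_pot_shift {n : ℕ} (hn : 1 ≤ n) (h : ℂ) (z : Fin n → ℂ) (γ : Idx n) :
    ∃ c, ∀ α, pot h (shift h z γ) α = potShift h (pot h z) γ α + c := by
  have hγ := γ.isLt
  -- For γ = 0 the shift lowers every potential except ξ_0 by ħ, that is, raises ξ_0 by ħ and then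
  -- lowers all of them.
  refine ⟨if γ.val = 0 then -h else 0, fun α => ?_⟩
  have hα := α.isLt
  have e : ∀ j : Fin n, (if j.castSucc < α then shift h z γ j else 0) =
      (if j.castSucc < α then z j else 0) -
        ((if j.val = γ.val then (if γ.val < α.val then h else 0) else 0) -
        (if j.val = γ.val - 1 then
          (if 0 < γ.val ∧ γ.val ≤ α.val then parSign γ * h else 0) else 0)) := by
    intro j
    have hj := j.isLt
    simp only [shift, mu_eq, parSign, Fin.lt_def, Fin.val_castSucc, Fin.ext_iff, Fin.val_last]
    split_ifs <;> first | omega | (push_cast; ring)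
  simp only [pot, e, Finset.sum_sub_distrib, sum_fin_ite_val_eq, potShift, Pi.add_apply,
    Pi.single_apply, parSign, Fin.ext_iff, Fin.val_last]
  split_ifs <;> first | omega | ring

lemma numOp_add_const {n : ℕ} {f : ℂ → ℂ} {h u c : ℂ} {ξ ξ' : Idx n → ℂ}
    (hc : ∀ α, ξ' α = ξ α + c) : numOp f h u ξ' = numOp f h u ξ := by
  have : ∀ α β, ξ' β - ξ' α = ξ β - ξ α := fun α β => by rw [hc, hc]; ring
  simp only [numOp,
    show exchAmp f h u ξ' = exchAmp f h u ξ from funext fun α => funext fun β => by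
      rw [exchAmp, exchAmp, this],
    show transGauge f h ξ' = transGauge f h ξ from funext fun α => funext fun β => by
      rw [transGauge, transGauge, this]]

/-- Oddness of theta turns θ(ħ−u) into −θ(u−ħ); this is the sign in `exch` and the parity sign in
`diagAmp`. -/
lemma rMat_eq_numOp {n : ℕ} {q h u : ℂ} (hu : RegularU q h u) (z : Fin n → ℂ) :
    rMat q h u z = (theta q (u - h))⁻¹ • numOp (theta q) h u (pot h z) := by
  have hu' : theta q (u - h) ≠ 0 := hu
  have hneg : theta q (-u + h) = -theta q (u - h) := by
    rw [← theta_neg]; congr 1; ring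
  ext p ⟨α, β⟩
  simp only [rMat, rApply, numOp, weightOp, Matrix.of_apply, Matrix.smul_apply, diagAmp]
  rcases lt_trichotomy α β with h1 | h1 | h1
  · have hB : fB q h u (zsum z α β - hdelta h β) =
        (theta q (u - h))⁻¹ * exchAmp (theta q) h u (pot h z) α β := by
      rw [fB, exchAmp, exch, pot_sub_pot h z h1, hneg]
      field_simp
    rw [if_neg h1.ne, if_pos h1, if_neg h1.ne, transGauge, if_pos h1, hB, fC]
    simp only [Pi.add_apply, Pi.smul_apply, smul_eq_mul]
    ring
  · subst h1
    rw [if_pos rfl, if_pos rfl]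
    by_cases h2 : α = Fin.last n
    · rw [if_pos h2, parSign, if_pos h2, fD, hneg]
      simp only [Pi.smul_apply, smul_eq_mul, neg_one_mul, sub_neg_eq_add]
      field_simp
    · rw [if_neg h2, parSign, if_neg h2]
      simp only [Pi.smul_apply, smul_eq_mul, one_mul]
      field_simp
  · have hB : fB q h u (-zsum z β α + hdelta h α) =
        (theta q (u - h))⁻¹ * exchAmp (theta q) h u (pot h z) α β := by
      rw [fB, exchAmp, exch, ← neg_sub (pot h z α), pot_sub_pot h z h1, hneg, neg_sub,
        neg_add_eq_sub]
      field_simp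
    have hA : fA q h u (zsum z β α - hdelta h α) =
        (theta q (u - h))⁻¹ * (theta q u * transGauge (theta q) h (pot h z) α β) := by
      have ht : trans2 (theta q) h (pot h z β - pot h z α) =
          trans2 (theta q) h (zsum z β α - hdelta h α) := by
        rw [← pot_sub_pot h z h1, ← neg_sub (pot h z α), trans2, trans2, theta_neg,
          show -(pot h z α - pot h z β) + h = -((pot h z α - pot h z β) - h) by ring,
          show -(pot h z α - pot h z β) - h = -((pot h z α - pot h z β) + h) by ring,
          theta_neg, theta_neg]
        ring
      rw [fA, transGauge, if_neg h1.not_gt, ht, trans2, ← div_div]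
      ring
    rw [if_neg h1.ne', if_neg h1.not_gt, if_neg h1.ne', hA, hB]
    simp only [Pi.add_apply, Pi.smul_apply, smul_eq_mul]
    ring

lemma theta_pot_ne_zero {n : ℕ} {q h : ℂ} {z : Fin n → ℂ} (hz : RegularZ q h z) {α β : Idx n}
    (hαβ : α ≠ β) : theta q (pot h z β - pot h z α) ≠ 0 := by
  rcases lt_or_gt_of_ne hαβ with h1 | h1
  · rw [pot_sub_pot h z h1]
    exact hz _ _ h1
  · rw [← neg_sub, theta_neg, neg_ne_zero, pot_sub_pot h z h1]
    exact hz _ _ h1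

lemma potRegular_pot {n : ℕ} (hn : 1 ≤ n) {q h : ℂ} {z : Fin n → ℂ} (hz : RegularZ q h z)
    (hs : ∀ γ : Idx n, RegularZ q h (shift h z γ)) : PotRegular (theta q) h (pot h z) where
  ne_zero _ _ hαβ := theta_pot_ne_zero hz hαβ
  shift_ne_zero α β hαβ := by
    obtain ⟨c, hc⟩ := exists_pot_shift hn h z α
    have := theta_pot_ne_zero (hs α) hαβ
    rwa [hc, hc, potShift_self, potShift_of_ne hαβ.symm, add_sub_add_right_eq_sub,
      sub_add_eq_sub_sub] at this

lemma leg12_smul {n : ℕ} (c : ℂ) (f : Idx n → Op2 n) : leg12 (fun γ => c • f γ) = c • leg12 f := by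
  ext p s; simp [leg12]

lemma leg13_smul {n : ℕ} (c : ℂ) (f : Idx n → Op2 n) : leg13 (fun γ => c • f γ) = c • leg13 f := by
  ext p s; simp [leg13]

lemma leg23_smul {n : ℕ} (c : ℂ) (f : Idx n → Op2 n) : leg23 (fun γ => c • f γ) = c • leg23 f := by
  ext p s; simp [leg23]

theorem rMat_yangBaxter {n : ℕ} (hn : 1 ≤ n) {q h u w : ℂ} {z : Fin n → ℂ} (h0 : 0 < ‖q‖)
    (hq : ‖q‖ < 1) (hu : RegularU q h u) (hw : RegularU q h w) (huw : RegularU q h (u + w))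
    (hz : RegularZ q h z) (hs : ∀ γ : Idx n, RegularZ q h (shift h z γ)) :
    leg12 (fun _ => rMat q h u z) * leg13 (fun γ => rMat q h (u + w) (shift h z γ)) *
        leg23 (fun _ => rMat q h w z) =
      leg23 (fun γ => rMat q h w (shift h z γ)) * leg13 (fun _ => rMat q h (u + w) z) *
        leg12 (fun γ => rMat q h u (shift h z γ)) := by
  have hshift : ∀ (v : ℂ) (γ : Idx n), numOp (theta q) h v (pot h (shift h z γ)) =
      numOp (theta q) h v (potShift h (pot h z) γ) := fun v γ =>
    numOp_add_const (exists_pot_shift hn h z γ).choose_spec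
  simp only [rMat_eq_numOp hu, rMat_eq_numOp hw, rMat_eq_numOp huw, leg12_smul, leg13_smul,
    leg23_smul, Matrix.smul_mul, Matrix.mul_smul, hshift]
  rw [numOp_yangBaxter (isSigmaLike_theta h0 hq) (potRegular_pot hn hz hs)]
  simp only [smul_smul]
  congr 1
  ring

section

/-! ### The weights of the fundamental representation -/

variable {n : ℕ}

lemma neg_one_pow_parity (α : Idx n) : (-1 : ℂ) ^ parity α = parSign α := by
  rw [parity, parSign]; split_ifs <;> simp

lemma mu_cast_eq (α : Idx n) (i : Fin n) : (mu α i : ℂ) =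
    (if α.val = i.val then 1 else 0) - parSign α * (if α.val = i.val + 1 then 1 else 0) := by
  simp only [mu_eq, parSign, eq_comm (a := i.val), eq_comm (a := i.val + 1)]
  push_cast
  rfl

lemma oddPart_diagonal (d : Idx n → ℂ) : oddPart (Matrix.diagonal d) = 0 := by
  ext α β
  by_cases h : α = β
  · simp [oddPart, h]
  · simp [oddPart, Matrix.diagonal_apply_ne d h]

lemma oddPart_single (α β : Idx n) : oddPart (Matrix.single α β (1 : ℂ)) =
    if parity α = parity β then 0 else Matrix.single α β 1 := by
  ext i j
  by_cases h : α = i ∧ β = j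
  · obtain ⟨rfl, rfl⟩ := h
    by_cases hp : parity α = parity β <;> simp [oddPart, hp]
  · by_cases hp : parity α = parity β <;> simp [oddPart, hp, Matrix.single_apply_of_ne _ _ _ _ _ h]

/-- At the last node e and f are odd, so the bracket is an anticommutator and the second diagonal
unit enters with a plus sign. -/
lemma chevH_eq_diagonal (i : Fin n) : chevH i = Matrix.diagonal fun α => (mu α i : ℂ) := by
  have hi := i.isLt
  have h0 : parity i.castSucc = 0 := if_neg (Fin.castSucc_lt_last i).ne
  have key : chevH i = Matrix.single i.castSucc i.castSucc 1 -
      parSign i.succ • Matrix.single i.succ i.succ (1 : ℂ) := by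
    rw [chevH, superBracket, chevE, chevF, Matrix.single_mul_single_same,
      Matrix.single_mul_single_same, oddPart_single, oddPart_single, h0, mul_one]
    by_cases h : i.succ = Fin.last n
    · have h1 : parity i.succ = 1 := if_pos h
      rw [h1, if_neg one_ne_zero, if_neg zero_ne_one, Matrix.single_mul_single_same, parSign,
        if_pos h, mul_one]
      module
    · have h1 : parity i.succ = 0 := if_neg h
      rw [h1, if_pos rfl, if_pos rfl, parSign, if_neg h]
      simp
  rw [key, ← Matrix.diagonal_single, ← Matrix.diagonal_single, ← Matrix.diagonal_smul,
    Matrix.diagonal_sub]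
  congr 1
  funext α
  rw [mu_cast_eq]
  simp only [Pi.smul_apply, Pi.single_apply, Fin.ext_iff, Fin.val_castSucc, Fin.val_succ,
    smul_eq_mul]
  by_cases h : α.val = i.val + 1
  · rw [show α = i.succ from Fin.ext h]
  · simp [h]

/-- From v_{j−1} to v_j the gauge vector grows by the j-th unit vector, so μ drops by the j-th
column of the Cartan matrix. -/
lemma mu_sub_mu (i j : Fin n) :
    (mu j.castSucc i : ℂ) - (mu j.succ i : ℂ) = (cartanMatrix n i j : ℂ) := by
  have hi := i.isLt
  have hj := j.isLt
  rw [← Int.cast_sub, mu_eq, mu_eq]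
  congr 1
  simp only [cartanMatrix, Matrix.of_apply, Fin.ext_iff, Fin.val_castSucc, Fin.val_succ,
    Fin.val_last]
  split_ifs <;> omega

lemma superBracket_diagonal_single (d : Idx n → ℂ) (α β : Idx n) :
    superBracket (Matrix.diagonal d) (Matrix.single α β 1) =
      (d α - d β) • Matrix.single α β (1 : ℂ) := by
  rw [superBracket, oddPart_diagonal, mul_zero, smul_zero, add_zero, sub_smul,
    Matrix.smul_single, Matrix.smul_single]
  congr 1
  · ext i j
    rw [Matrix.diagonal_mul, Matrix.single_apply, Matrix.single_apply]
    split_ifs with h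
    · rw [h.1]; simp
    · simp
  · ext i j
    rw [Matrix.mul_diagonal, Matrix.single_apply, Matrix.single_apply]
    split_ifs with h
    · rw [h.2]; simp
    · simp

lemma superBracket_chevH_chevE (i j : Fin n) :
    superBracket (chevH i) (chevE j) = (cartanMatrix n i j : ℂ) • chevE j := by
  rw [chevH_eq_diagonal, chevE, superBracket_diagonal_single, mu_sub_mu]

lemma superBracket_chevH_chevF (i j : Fin n) :
    superBracket (chevH i) (chevF j) = -(cartanMatrix n i j : ℂ) • chevF j := by
  rw [chevH_eq_diagonal, chevF, superBracket_diagonal_single, ← mu_sub_mu, neg_sub]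

lemma chevH_mulVec_single (i : Fin n) (α : Idx n) :
    (chevH i).mulVec (Pi.single α 1) = (mu α i : ℂ) • Pi.single α 1 := by
  rw [chevH_eq_diagonal]
  ext β
  rw [Matrix.mulVec_diagonal, Pi.smul_apply, Pi.single_apply]
  split_ifs with h
  · rw [h]; simp
  · simp

/-- The sum of the first `m` diagonal entries. -/
def partialTrace (m : ℕ) (d : Idx n → ℂ) : ℂ := ∑ α : Idx n, if α.val < m then d α else 0

lemma partialTrace_succ (d : Idx n → ℂ) (α : Idx n) :
    partialTrace (α.val + 1) d = partialTrace α.val d + d α := by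
  have : d α = ∑ β : Idx n, if β = α then d β else 0 := by simp
  rw [partialTrace, partialTrace, this, ← Finset.sum_add_distrib]
  refine Finset.sum_congr rfl fun β _ => ?_
  simp only [Fin.ext_iff]
  split_ifs <;> first | omega | simp

/-- Partial traces are the coordinates dual to the h_i, which gives linear independence. -/
lemma partialTrace_mu (i k : Fin n) :
    partialTrace (k.val + 1) (fun α => (mu α i : ℂ)) = if i = k then 1 else 0 := by
  have hi := i.isLt
  have hk := k.isLt
  have e : ∀ α : Idx n, (if α.val < k.val + 1 then (mu α i : ℂ) else 0) =
      (if α.val = i.val then (if i.val < k.val + 1 then 1 else 0) else 0) -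
      (if α.val = i.val + 1 then (if i.val + 1 < k.val + 1 then 1 else 0) else 0) := by
    intro α
    simp only [mu_cast_eq, parSign, Fin.ext_iff, Fin.val_last]
    split_ifs <;> first | omega | simp
  simp only [partialTrace, e, Finset.sum_sub_distrib, sum_fin_ite_val_eq, Fin.ext_iff]
  split_ifs <;> first | omega | simp

lemma superTrace_diagonal (d : Idx n → ℂ) :
    superTrace (Matrix.diagonal d) = partialTrace n d - d (Fin.last n) := by
  have : d (Fin.last n) = ∑ β : Idx n, if β = Fin.last n then d β else 0 := by simp
  change ∑ α : Idx n, (-1 : ℂ) ^ parity α * Matrix.diagonal d α α = _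
  rw [partialTrace, this, ← Finset.sum_sub_distrib]
  refine Finset.sum_congr rfl fun β _ => ?_
  have hβ := β.isLt
  rw [neg_one_pow_parity, parSign, Matrix.diagonal_apply_eq]
  simp only [Fin.ext_iff, Fin.val_last]
  split_ifs <;> first | omega | simp

/-- Consecutive partial traces differ by one diagonal entry; at the odd label, where no further node
exists, vanishing supertrace supplies the value. -/
lemma sum_partialTrace_mul_mu {d : Idx n → ℂ} (hd : partialTrace n d = d (Fin.last n))
    (α : Idx n) : ∑ k : Fin n, partialTrace (k.val + 1) d * (mu α k : ℂ) = d α := by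
  have hα := α.isLt
  have e : ∀ k : Fin n, partialTrace (k.val + 1) d * (mu α k : ℂ) =
      (if k.val = α.val then partialTrace (α.val + 1) d else 0) -
      (if k.val = α.val - 1 then (if 0 < α.val then parSign α * partialTrace α.val d else 0)
        else 0) := by
    intro k
    rw [mu_cast_eq, mul_sub, mul_left_comm]
    congr 1
    · by_cases h : α.val = k.val
      · simp [h]
      · simp [h, Ne.symm h]
    · by_cases h : α.val = k.val + 1
      · simp [h]
      · rw [if_neg h]
        split_ifs <;> first | omega | simp
  have h0 : partialTrace 0 d = 0 := by simp [partialTrace]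
  simp only [e, Finset.sum_sub_distrib, sum_fin_ite_val_eq]
  by_cases hl : α = Fin.last n
  · subst hl
    rw [if_neg (by simp), parSign, if_pos rfl, Fin.val_last]
    by_cases hn : 0 < n
    · rw [if_pos (by omega), if_pos hn, hd]; ring
    · obtain rfl : n = 0 := by omega
      rw [← hd, h0]; simp
  · have hlt : α.val < n := by
      have : α.val ≠ n := fun h => hl (Fin.ext h)
      omega
    rw [if_pos hlt, if_pos (by omega), parSign, if_neg hl, partialTrace_succ]
    split_ifs with h
    · ring
    · rw [show α.val = 0 by omega, h0]; ring

lemma sum_smul_chevH (g : Fin n → ℂ) :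
    ∑ i, g i • chevH i = Matrix.diagonal fun α => ∑ i, g i * (mu α i : ℂ) := by
  simp only [chevH_eq_diagonal, ← Matrix.diagonal_smul]
  ext α β
  rw [Matrix.sum_apply]
  by_cases h : α = β
  · subst h; simp
  · simp [Matrix.diagonal_apply_ne _ h]

lemma linearIndependent_chevH : LinearIndependent ℂ (chevH (n := n)) := by
  rw [Fintype.linearIndependent_iff]
  intro g hg k
  rw [sum_smul_chevH] at hg
  have h1 : ∀ α : Idx n, ∑ i, g i * (mu α i : ℂ) = 0 := fun α => by
    simpa using congrFun (congrFun hg α) α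
  have h2 : partialTrace (k.val + 1) (fun α : Idx n => ∑ i, g i * (mu α i : ℂ)) = g k := by
    have : partialTrace (k.val + 1) (fun α : Idx n => ∑ i, g i * (mu α i : ℂ)) =
        ∑ i, g i * partialTrace (k.val + 1) (fun α : Idx n => (mu α i : ℂ)) := by
      simp only [partialTrace, Finset.mul_sum, mul_ite, mul_zero]
      rw [Finset.sum_comm]
      refine Finset.sum_congr rfl fun α _ => ?_
      split_ifs <;> simp
    rw [this]
    simp [partialTrace_mu]
  rw [← h2]
  simp [partialTrace, h1]

lemma span_chevH : Submodule.span ℂ (Set.range (chevH (n := n))) = cartanSub n := by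
  apply le_antisymm
  · rw [Submodule.span_le]
    rintro _ ⟨i, rfl⟩
    refine ⟨?_, fun α => (mu α i : ℂ), (chevH_eq_diagonal i).symm⟩
    have hi := i.isLt
    change superTrace (chevH i) = 0
    rw [chevH_eq_diagonal, superTrace_diagonal]
    obtain ⟨m, rfl⟩ : ∃ m, n = m + 1 := ⟨n - 1, by omega⟩
    rw [sub_eq_zero, mu_cast_eq, parSign, if_pos rfl]
    refine (partialTrace_mu i (Fin.last m)).trans ?_
    simp only [Fin.ext_iff, Fin.val_last]
    split_ifs <;> first | omega | simp
  · rintro _ ⟨hM, d, rfl⟩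
    change superTrace (Matrix.diagonal d) = 0 at hM
    rw [superTrace_diagonal, sub_eq_zero] at hM
    have : Matrix.diagonalLinearMap (Idx n) ℂ ℂ d =
        ∑ k : Fin n, partialTrace (k.val + 1) d • chevH k := by
      rw [sum_smul_chevH]
      exact congrArg Matrix.diagonal (funext fun α => (sum_partialTrace_mul_mu hM α).symm)
    rw [this]
    exact Submodule.sum_mem _ fun k _ =>
      Submodule.smul_mem _ _ (Submodule.subset_span ⟨k, rfl⟩)

end

section

/-! ### The trigonometric limit of the theta function -/

section ThetaLimit

variable {ι : Type*} {l : Filter ι} {q x : ι → ℂ}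

lemma tendsto_theta_prod (hq : Tendsto q l (𝓝 0))
    (h1 : Tendsto (fun i => Complex.exp (x i) * q i) l (𝓝 0))
    (h2 : Tendsto (fun i => Complex.exp (-x i) * q i) l (𝓝 0)) :
    Tendsto (fun i => ∏' k : ℕ, ((1 - Complex.exp (x i) * q i ^ (k + 1)) *
      (1 - Complex.exp (-x i) * q i ^ (k + 1)))) l (𝓝 1) := by
  have key := tendsto_tprod_one_add_of_dominated_convergence (𝓕 := l) (R := ℂ)
    (f := fun i (k : ℕ) => -(Complex.exp (x i) * q i * q i ^ k) -
      Complex.exp (-x i) * q i * q i ^ k +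
      Complex.exp (x i) * q i * (Complex.exp (-x i) * q i) * (q i ^ k * q i ^ k))
    -- Each of the three summands of f is at most (1/2)^k once |e^{±x} q| ≤ 1 and |q| ≤ 1/2.
    (g := fun _ => 0) (bound := fun k => 3 * (1 / 2 : ℝ) ^ k)
    ((summable_geometric_of_lt_one (by norm_num) (by norm_num)).mul_left 3)
    (fun k => by
      have hk := hq.pow k
      have := ((h1.mul hk).neg.sub (h2.mul hk)).add ((h1.mul h2).mul (hk.mul hk))
      simpa using this)
    (by
      have e1 := h1.norm.eventually_le_const (u := 1) (by simp)
      have e2 := h2.norm.eventually_le_const (u := 1) (by simp)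
      have e3 := hq.norm.eventually_le_const (u := 1 / 2) (by simp)
      filter_upwards [e1, e2, e3] with i a1 a2 a3 k
      have a4 : ‖q i ^ k‖ ≤ (1 / 2) ^ k := by
        rw [norm_pow]; exact pow_le_pow_left₀ (norm_nonneg _) a3 k
      have a5 : ‖q i ^ k‖ ≤ 1 := a4.trans (pow_le_one₀ (by norm_num) (by norm_num))
      refine (norm_add_le _ _).trans ?_
      refine (add_le_add (norm_sub_le _ _) le_rfl).trans ?_
      rw [norm_neg, norm_mul, norm_mul (Complex.exp (-x i) * q i), norm_mul (_ * _ * (_ * _)),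
        norm_mul (_ * _) (_ * _), norm_mul (q i ^ k)]
      have n0 := norm_nonneg (q i ^ k)
      have b1 := mul_le_of_le_one_left n0 a1
      have b2 := mul_le_of_le_one_left n0 a2
      have b3 : ‖Complex.exp (x i) * q i‖ * ‖Complex.exp (-x i) * q i‖ ≤ 1 :=
        mul_le_one₀ a1 (norm_nonneg _) a2
      have b4 := mul_le_of_le_one_left (mul_nonneg n0 n0) b3
      have b5 := mul_le_of_le_one_left n0 a5
      linarith)
  simp only [add_zero, tprod_one] at key
  refine key.congr fun i => tprod_congr fun k => ?_
  ring

/-- `2 sinh (x / 2)`. -/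
def twoSinh (x : ℂ) : ℂ := Complex.exp (x / 2) - Complex.exp (-(x / 2))

lemma twoSinh_ne_zero {x : ℂ} (hx : Complex.exp x ≠ 1) : twoSinh x ≠ 0 := by
  intro h
  apply hx
  rw [twoSinh, sub_eq_zero] at h
  calc Complex.exp x = Complex.exp (x / 2) * Complex.exp (x / 2) := by
        rw [← Complex.exp_add, add_halves]
    _ = Complex.exp (x / 2) * Complex.exp (-(x / 2)) := by rw [← h]
    _ = 1 := by rw [← Complex.exp_add, add_neg_cancel, Complex.exp_zero]

lemma tendsto_theta_const (hq : Tendsto q l (𝓝 0)) (y : ℂ) :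
    Tendsto (fun i => theta (q i) y) l (𝓝 (twoSinh y)) := by
  have := (tendsto_theta_prod (x := fun _ => y) hq (by simpa using hq.const_mul (Complex.exp y))
    (by simpa using hq.const_mul (Complex.exp (-y)))).const_mul (twoSinh y)
  rwa [mul_one] at this

lemma gaussSum_add_int_mul (L y : ℂ) (m : ℤ) : gaussSum (L / 2) (y + m * L) =
    Complex.exp (-(m * y) - m ^ 2 * (L / 2)) * gaussSum (L / 2) y := by
  rw [gaussSum, gaussSum, ← tsum_mul_left, ← (Equiv.subRight m).tsum_eq]
  refine tsum_congr fun j => ?_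
  simp only [gaussTerm, Equiv.subRight_apply, ← Complex.exp_add]
  congr 1
  push_cast
  ring

/-- Quasi-periodicity of the theta function. -/
lemma theta_add_int_mul {q L : ℂ} (hL : Complex.exp L = q) (hq : ‖q‖ < 1) (x : ℂ) (m : ℤ) :
    theta q (x + m * L) =
      Complex.exp (-(m * x) - m * (Real.pi * Complex.I) - m ^ 2 * (L / 2)) * theta q x := by
  rw [theta_eq_gaussSum hL hq, theta_eq_gaussSum hL hq,
    show x + m * L + Real.pi * Complex.I - L / 2 = x + Real.pi * Complex.I - L / 2 + m * L by ring,
    gaussSum_add_int_mul]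
  have : Complex.exp (-((x + m * L) / 2)) *
      Complex.exp (-(m * (x + Real.pi * Complex.I - L / 2)) - m ^ 2 * (L / 2)) =
      Complex.exp (-(m * x) - m * (Real.pi * Complex.I) - m ^ 2 * (L / 2)) *
        Complex.exp (-(x / 2)) := by
    rw [← Complex.exp_add, ← Complex.exp_add]; congr 1; ring
  linear_combination -(qPochInf q)⁻¹ * gaussSum (L / 2) (x + Real.pi * Complex.I - L / 2) * this

lemma tendsto_log_norm (hq : Tendsto q l (𝓝[≠] 0)) :
    Tendsto (fun i => Real.log ‖q i‖) l atBot :=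
  Real.tendsto_log_nhdsNE_zero.comp ((tendsto_norm_nhdsNE_zero.comp hq).mono_right
    (nhdsWithin_mono _ fun _ h => (ne_of_gt h)))

lemma tendsto_slope_add_const (hq : Tendsto q l (𝓝[≠] 0)) {σ : ℝ}
    (hx : Tendsto (fun i => (x i).re / Real.log ‖q i‖) l (𝓝 σ)) (c : ℂ) :
    Tendsto (fun i => (x i + c).re / Real.log ‖q i‖) l (𝓝 σ) := by
  have := hx.add ((tendsto_log_norm hq).const_div_atBot c.re)
  rw [add_zero] at this
  exact this.congr fun i => by rw [Complex.add_re, add_div]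

/-- For 0 < σ < 1 both e^x, of size about |q|^σ, and e^{−x}q, of size about |q|^{1−σ}, tend to 0;
the infinite product tends to 1 and e^x − 1 to −1. -/
lemma tendsto_theta_mul_exp (hq : Tendsto q l (𝓝[≠] 0)) {σ : ℝ} (h0 : 0 < σ) (h1 : σ < 1)
    (hx : Tendsto (fun i => (x i).re / Real.log ‖q i‖) l (𝓝 σ)) :
    Tendsto (fun i => theta (q i) (x i) * Complex.exp (x i / 2)) l (𝓝 (-1)) := by
  have hq0 : Tendsto q l (𝓝 0) := hq.mono_right nhdsWithin_le_nhds
  have hne : ∀ᶠ i in l, q i ≠ 0 := hq.eventually self_mem_nhdsWithin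
  have hlog := tendsto_log_norm hq
  have hlog0 : ∀ᶠ i in l, Real.log ‖q i‖ < 0 := hlog.eventually_lt_atBot 0
  have e1 : Tendsto (fun i => Complex.exp (x i)) l (𝓝 0) := by
    rw [tendsto_zero_iff_norm_tendsto_zero]
    refine (Real.tendsto_exp_atBot.comp (hx.pos_mul_atBot h0 hlog)).congr' ?_
    filter_upwards [hlog0] with i hi
    rw [Function.comp_apply, Complex.norm_exp, div_mul_cancel₀ _ hi.ne]
  have e2 : Tendsto (fun i => Complex.exp (-x i) * q i) l (𝓝 0) := by
    rw [tendsto_zero_iff_norm_tendsto_zero]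
    refine (Real.tendsto_exp_atBot.comp
      ((hx.const_sub 1).pos_mul_atBot (sub_pos.mpr h1) hlog)).congr' ?_
    filter_upwards [hlog0, hne] with i hi hi'
    rw [Function.comp_apply, norm_mul, Complex.norm_exp, sub_mul, div_mul_cancel₀ _ hi.ne, one_mul,
      Complex.neg_re, sub_eq_add_neg, Real.exp_add, Real.exp_log (norm_pos_iff.mpr hi'), mul_comm]
  have e3 := tendsto_theta_prod hq0 (by simpa using e1.mul hq0) e2
  have := (e1.sub_const 1).mul e3
  rw [zero_sub, mul_one] at this
  refine this.congr fun i => ?_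
  have hE : Complex.exp (x i) = Complex.exp (x i / 2) * Complex.exp (x i / 2) := by
    rw [← Complex.exp_add, add_halves]
  have hI : Complex.exp (-(x i / 2)) * Complex.exp (x i / 2) = 1 := by
    rw [← Complex.exp_add]; simp
  rw [theta]
  linear_combination (∏' k : ℕ, ((1 - Complex.exp (x i) * q i ^ (k + 1)) *
    (1 - Complex.exp (-x i) * q i ^ (k + 1)))) * (hE + hI)

/-- Subtracting ⌊σ⌋ log q from x brings the slope into (0,1), where the ratio tends to e^{−u/2}; the
quasi-period multipliers contribute e^{−⌊σ⌋u}. -/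
lemma tendsto_theta_div_theta (hq : Tendsto q l (𝓝[≠] 0)) {σ : ℝ} (hσ : ∀ k : ℤ, σ ≠ k)
    (hx : Tendsto (fun i => (x i).re / Real.log ‖q i‖) l (𝓝 σ)) (u : ℂ) :
    Tendsto (fun i => theta (q i) (x i + u) / theta (q i) (x i)) l
      (𝓝 (Complex.exp (-((⌊σ⌋ + 1 / 2) * u)))) := by
  have hne : ∀ᶠ i in l, q i ≠ 0 := hq.eventually self_mem_nhdsWithin
  have hlog0 : ∀ᶠ i in l, Real.log ‖q i‖ < 0 := (tendsto_log_norm hq).eventually_lt_atBot 0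
  set m := ⌊σ⌋ with hm
  set x₀ : ι → ℂ := fun i => x i - m * Complex.log (q i) with hx₀
  have hx₀' : Tendsto (fun i => (x₀ i).re / Real.log ‖q i‖) l (𝓝 (σ - m)) := by
    refine (hx.sub_const (m : ℝ)).congr' ?_
    filter_upwards [hlog0] with i hi
    rw [hx₀, Complex.sub_re, ← Complex.ofReal_intCast, Complex.re_ofReal_mul, Complex.log_re,
      sub_div, mul_div_cancel_right₀ _ hi.ne]
  have hpos : 0 < σ - m := sub_pos.mpr (lt_of_le_of_ne (Int.floor_le σ) (hσ m).symm)
  have hlt : σ - m < 1 := by linarith [Int.lt_floor_add_one σ]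
  have t1 := tendsto_theta_mul_exp hq hpos hlt hx₀'
  have t2 := tendsto_theta_mul_exp hq hpos hlt (tendsto_slope_add_const hq hx₀' u)
  have t3 := (t2.div t1 (by norm_num)).mul_const (Complex.exp (-((m + 1 / 2) * u)))
  rw [div_self (by norm_num), one_mul] at t3
  refine t3.congr' ?_
  filter_upwards [hne, hlog0] with i hi hi'
  have hq1 : ‖q i‖ < 1 := by
    by_contra h
    exact hi'.not_ge (Real.log_nonneg (not_lt.mp h))
  have hL := Complex.exp_log hi
  have r1 : x i + u = x₀ i + u + m * Complex.log (q i) := by rw [hx₀]; ring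
  have r2 : x i = x₀ i + m * Complex.log (q i) := by rw [hx₀]; ring
  rw [Pi.div_apply, r1, theta_add_int_mul hL hq1, r2, theta_add_int_mul hL hq1]
  set M := Complex.exp (-(m * x₀ i) - m * (Real.pi * Complex.I) - m ^ 2 * (Complex.log (q i) / 2))
    with hM
  have r3 : Complex.exp (-(m * (x₀ i + u)) - m * (Real.pi * Complex.I) -
      m ^ 2 * (Complex.log (q i) / 2)) = M * Complex.exp (-(m * u)) := by
    rw [hM, ← Complex.exp_add]; congr 1; ring
  have r4 : Complex.exp (-((m + 1 / 2) * u)) * Complex.exp ((x₀ i + u) / 2) =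
      Complex.exp (-(m * u)) * Complex.exp (x₀ i / 2) := by
    rw [← Complex.exp_add, ← Complex.exp_add]; congr 1; ring
  rw [r3, mul_assoc M, mul_div_mul_left _ _ (Complex.exp_ne_zero _), ← mul_div_right_comm,
    mul_assoc (theta _ _) (Complex.exp _), mul_comm (Complex.exp ((x₀ i + u) / 2)), r4,
    ← mul_assoc, mul_div_mul_right _ _ (Complex.exp_ne_zero _), mul_comm (theta _ _)]

lemma tendsto_theta_mul_div_sq (hq : Tendsto q l (𝓝[≠] 0)) {σ : ℝ} (hσ : ∀ k : ℤ, σ ≠ k)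
    (hx : Tendsto (fun i => (x i).re / Real.log ‖q i‖) l (𝓝 σ)) (u : ℂ) :
    Tendsto (fun i => theta (q i) (x i + u) * theta (q i) (x i - u) / theta (q i) (x i) ^ 2) l
      (𝓝 1) := by
  have := (tendsto_theta_div_theta hq hσ hx u).mul (tendsto_theta_div_theta hq hσ hx (-u))
  rw [← Complex.exp_add, mul_neg, neg_neg, neg_add_cancel, Complex.exp_zero] at this
  refine this.congr fun i => ?_
  rw [div_mul_div_comm, ← sq, ← sub_eq_add_neg]

end ThetaLimit

end

section

/-! ### The rational limit -/

variable {n : ℕ}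

lemma tendsto_weightOp {ι : Type*} {l : Filter ι} {d : ι → Idx n → ℂ} {a b : ι → Idx n → Idx n → ℂ}
    {d₀ : Idx n → ℂ} {a₀ b₀ : Idx n → Idx n → ℂ} (hd : ∀ α, Tendsto (d · α) l (𝓝 (d₀ α)))
    (ha : ∀ α β, α ≠ β → Tendsto (a · α β) l (𝓝 (a₀ α β)))
    (hb : ∀ α β, α ≠ β → Tendsto (b · α β) l (𝓝 (b₀ α β))) :
    Tendsto (fun i => weightOp (d i) (a i) (b i)) l (𝓝 (weightOp d₀ a₀ b₀)) := by
  refine tendsto_pi_nhds.mpr fun p => tendsto_pi_nhds.mpr fun s => ?_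
  obtain ⟨α, β⟩ := s
  by_cases h : α = β
  · simp only [weightOp, Matrix.of_apply, h, if_true, Pi.smul_apply, smul_eq_mul]
    exact (hd β).mul_const _
  · simp only [weightOp, Matrix.of_apply, h, if_false, Pi.smul_apply, Pi.add_apply, smul_eq_mul]
    exact ((ha α β h).mul_const _).add ((hb α β h).mul_const _)

lemma rMat_eq_weightOp (q h u : ℂ) (z : Fin n → ℂ) : rMat q h u z = weightOp
    (fun α => if α = Fin.last n then fD q h u else 1)
    (fun α β => if α < β then fC q h u else fA q h u (zsum z β α - hdelta h α))
    (fun α β => fB q h u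
      (if α < β then zsum z α β - hdelta h β else -zsum z β α + hdelta h α)) := by
  ext p ⟨α, β⟩
  simp only [rMat, weightOp, rApply, Matrix.of_apply]
  split_ifs <;> simp_all

/-- The slope of the dynamical variable that enters the exchange amplitude. -/
def pairSlope (s : Fin n → ℝ) (α β : Idx n) : ℝ := if α < β then zsum s α β else -zsum s β α

lemma GenericSlope.pairSlope_ne {s : Fin n → ℝ} (hs : GenericSlope s) {α β : Idx n} (h : α ≠ β)
    (k : ℤ) : pairSlope s α β ≠ k := by
  rw [pairSlope]
  split_ifs with h1
  · exact hs α β h1 k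
  · have := hs β α (lt_of_le_of_ne (not_lt.mp h1) h.symm) (-k)
    rw [Int.cast_neg] at this
    exact fun h2 => this (by rw [← h2, neg_neg])

/-- The trigonometric limit of the R-matrix at the slope `s`. -/
def trigMat (s : Fin n → ℝ) (h u : ℂ) : Op2 n := weightOp
  (fun α => if α = Fin.last n then twoSinh (u + h) / twoSinh (-u + h) else 1)
  (fun _ _ => twoSinh u / twoSinh (u - h))
  (fun α β => twoSinh h / twoSinh (-u + h) *
    Complex.exp (-((⌊pairSlope s α β⌋ + 1 / 2) * u)))

lemma tendsto_fst_slopeFilter (s : Fin n → ℝ) :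
    Tendsto Prod.fst (slopeFilter s) (𝓝[≠] (0 : ℂ)) :=
  tendsto_comap.mono_left inf_le_left

lemma tendsto_zsum_slopeFilter (s : Fin n → ℝ) (α β : Idx n) :
    Tendsto (fun p : ℂ × (Fin n → ℂ) => (zsum p.2 α β).re / Real.log ‖p.1‖) (slopeFilter s)
      (𝓝 (zsum s α β)) := by
  have h : Tendsto (fun (p : ℂ × (Fin n → ℂ)) i => (p.2 i).re / Real.log ‖p.1‖) (slopeFilter s)
      (𝓝 s) := tendsto_comap.mono_left inf_le_right
  have h' := tendsto_pi_nhds.mp h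
  have : Tendsto (fun p : ℂ × (Fin n → ℂ) => ∑ j : Fin n,
      if α ≤ j.castSucc ∧ j.castSucc < β then (p.2 j).re / Real.log ‖p.1‖ else 0)
      (slopeFilter s) (𝓝 (zsum s α β)) := by
    refine tendsto_finsetSum _ fun j _ => ?_
    split_ifs
    · exact h' j
    · exact tendsto_const_nhds
  refine this.congr fun p => ?_
  rw [zsum, Complex.re_sum, Finset.sum_div]
  refine Finset.sum_congr rfl fun j _ => ?_
  split_ifs <;> simp

/-- The corrections ħδ are constant and do not affect slopes. In A the exponentials for ħ and −ħ
cancel, so A and C have the same limit. -/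
theorem tendsto_rMat {s : Fin n → ℝ} (hs : GenericSlope s) {h u : ℂ}
    (hu : Complex.exp u ≠ Complex.exp h) :
    Tendsto (fun p : ℂ × (Fin n → ℂ) => rMat p.1 h u p.2) (slopeFilter s)
      (𝓝 (trigMat s h u)) := by
  have hq := tendsto_fst_slopeFilter s
  have hq0 : Tendsto Prod.fst (slopeFilter s) (𝓝 (0 : ℂ)) := hq.mono_right nhdsWithin_le_nhds
  have n1 : twoSinh (u - h) ≠ 0 := twoSinh_ne_zero fun e => hu (by
    rw [← sub_add_cancel u h, Complex.exp_add, e, one_mul])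
  have n2 : twoSinh (-u + h) ≠ 0 := twoSinh_ne_zero fun e => hu (by
    rw [← add_neg_cancel_left u h, Complex.exp_add u, e, mul_one])
  have tθ : ∀ y : ℂ, Tendsto (fun p : ℂ × (Fin n → ℂ) => theta p.1 y) (slopeFilter s)
      (𝓝 (twoSinh y)) := fun y => tendsto_theta_const hq0 y
  have tC : Tendsto (fun p : ℂ × (Fin n → ℂ) => fC p.1 h u) (slopeFilter s)
      (𝓝 (twoSinh u / twoSinh (u - h))) := (tθ u).div (tθ (u - h)) n1
  simp only [rMat_eq_weightOp]
  refine tendsto_weightOp (fun α => ?_) (fun α β hαβ => ?_) (fun α β hαβ => ?_)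
  · split_ifs
    · exact (tθ (u + h)).div (tθ (-u + h)) n2
    · exact tendsto_const_nhds
  · split_ifs with h1
    · exact tC
    · have t := tendsto_theta_mul_div_sq hq (hs β α (lt_of_le_of_ne (not_lt.mp h1) hαβ.symm))
        (tendsto_slope_add_const hq (tendsto_zsum_slopeFilter s β α) (-hdelta h α)) h
      have := t.mul tC
      rw [one_mul] at this
      refine this.congr fun p => ?_
      rw [fA, fC, ← sub_eq_add_neg, div_mul_div_comm]
  · have t : Tendsto (fun p : ℂ × (Fin n → ℂ) => (if α < β then zsum p.2 α β - hdelta h β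
        else -zsum p.2 β α + hdelta h α).re / Real.log ‖p.1‖) (slopeFilter s)
        (𝓝 (pairSlope s α β)) := by
      rw [pairSlope]
      split_ifs with h1
      · exact tendsto_slope_add_const hq (tendsto_zsum_slopeFilter s α β) (-hdelta h β)
      · refine tendsto_slope_add_const hq ?_ (hdelta h α)
        exact (tendsto_zsum_slopeFilter s β α).neg.congr fun p => by rw [Complex.neg_re, neg_div]
    have := (((tθ h).div (tθ (-u + h)) n2).mul
      (tendsto_theta_div_theta hq (hs.pairSlope_ne hαβ) t u))
    refine this.congr fun p => ?_
    rw [Pi.div_apply, fB, div_mul_div_comm, add_comm u, mul_comm (theta p.1 (-u + h))]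

/-- The difference quotient at 0 of ε ↦ 2 sinh(εa/2), whose derivative there is a. -/
lemma tendsto_twoSinh_div (a : ℂ) :
    Tendsto (fun ε : ℂ => twoSinh (ε * a) / ε) (𝓝[≠] 0) (𝓝 a) := by
  have h1 : HasDerivAt (fun ε : ℂ => ε * a / 2) (a / 2) 0 := by
    simpa using ((hasDerivAt_id (0 : ℂ)).mul_const a).div_const 2
  have h2 : HasDerivAt (fun ε : ℂ => twoSinh (ε * a)) a 0 :=
    (h1.cexp.sub h1.fun_neg.cexp).congr_deriv (by simp)
  have := hasDerivAt_iff_tendsto_slope_zero.mp h2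
  simpa [twoSinh, div_eq_inv_mul] using this

lemma tendsto_twoSinh_div_twoSinh (a : ℂ) {b : ℂ} (hb : b ≠ 0) :
    Tendsto (fun ε : ℂ => twoSinh (ε * a) / twoSinh (ε * b)) (𝓝[≠] 0) (𝓝 (a / b)) := by
  refine ((tendsto_twoSinh_div a).div (tendsto_twoSinh_div b) hb).congr' ?_
  filter_upwards [self_mem_nhdsWithin] with ε hε
  exact div_div_div_cancel_right₀ hε _ _

lemma swapP_mulVec_tens (α β : Idx n) : (swapP n).mulVec (tens α β) = tens β α := by
  rw [tens, Matrix.mulVec_single_one]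
  rfl

lemma superSwap_mulVec_tens (α β : Idx n) :
    (superSwap n).mulVec (tens α β) = (-1 : ℂ) ^ (parity α * parity β) • tens β α := by
  rw [tens, Matrix.mulVec_single_one]
  rfl

lemma weightOp_mulVec_tens (d : Idx n → ℂ) (a b : Idx n → Idx n → ℂ) (α β : Idx n) :
    (weightOp d a b).mulVec (tens α β) =
      if α = β then d α • tens α β else a α β • tens α β + b α β • tens β α := by
  rw [tens, Matrix.mulVec_single_one]
  rfl

lemma rRat_eq_weightOp {h u : ℂ} (hu : u ≠ h) : rRat n h u = weightOp
    (fun α => if α = Fin.last n then (u + h) / (-u + h) else 1)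
    (fun _ _ => u / (u - h)) (fun _ _ => h / (-u + h)) := by
  have n1 : u - h ≠ 0 := sub_ne_zero.mpr hu
  have n2 : -u + h = -(u - h) := by ring
  refine Matrix.ext_of_mulVec_single fun i => ?_
  obtain ⟨α, β⟩ := i
  change (rRat n h u).mulVec (tens α β) = (weightOp _ _ _).mulVec (tens α β)
  rw [weightOp_mulVec_tens, rRat, ← Matrix.mulVec_mulVec, Matrix.sub_mulVec, Matrix.smul_mulVec,
    Matrix.smul_mulVec, Matrix.one_mulVec, superSwap_mulVec_tens, Matrix.mulVec_sub,
    Matrix.mulVec_smul, Matrix.mulVec_smul, Matrix.mulVec_smul, swapP_mulVec_tens,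
    swapP_mulVec_tens, n2]
  by_cases h1 : α = β
  · subst h1
    rw [if_pos rfl]
    by_cases h2 : α = Fin.last n
    · rw [if_pos h2, parity, if_pos h2, smul_smul, ← sub_smul]
      congr 1
      field_simp
      ring
    · rw [if_neg h2, parity, if_neg h2, smul_smul, ← sub_smul]
      congr 1
      field_simp
      ring
  · have h2 : parity α * parity β = 0 := by
      rw [parity, parity]
      split_ifs with h3 h4
      · exact absurd (h3.trans h4.symm) h1
      all_goals rfl
    rw [if_neg h1, h2, pow_zero, one_smul, div_neg, neg_smul, sub_eq_add_neg]

theorem tendsto_trigMat (s : Fin n → ℝ) {h u : ℂ} (hu : u ≠ h) :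
    Tendsto (fun ε : ℂ => trigMat s (ε * h) (ε * u)) (𝓝[≠] 0) (𝓝 (rRat n h u)) := by
  have n1 : u - h ≠ 0 := sub_ne_zero.mpr hu
  have n2 : -u + h ≠ 0 := by rw [neg_add_eq_sub]; exact sub_ne_zero.mpr hu.symm
  rw [rRat_eq_weightOp hu]
  simp only [trigMat, ← mul_add, ← mul_sub, ← mul_neg]
  refine tendsto_weightOp (fun α => ?_) (fun α β _ => ?_) (fun α β _ => ?_)
  · split_ifs
    · exact tendsto_twoSinh_div_twoSinh _ n2
    · exact tendsto_const_nhds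
  · exact tendsto_twoSinh_div_twoSinh _ n1
  · have t : Tendsto (fun ε : ℂ => Complex.exp ((⌊pairSlope s α β⌋ + 1 / 2) * -(ε * u))) (𝓝[≠] 0)
        (𝓝 1) := by
      have : Continuous fun ε : ℂ =>
          Complex.exp ((⌊pairSlope s α β⌋ + 1 / 2) * -(ε * u)) := by fun_prop
      simpa using (this.tendsto 0).mono_left nhdsWithin_le_nhds
    have := (tendsto_twoSinh_div_twoSinh h n2).mul t
    rw [mul_one] at this
    simpa only [mul_neg] using this

end

end SuperR

end

theorem mainTheorem7 (n : ℕ) (hn : 1 ≤ n) :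
    -- the dynamical Yang-Baxter equation
    (∀ (q h u w : ℂ) (z : Fin n → ℂ), 0 < ‖q‖ → ‖q‖ < 1 →
      SuperR.RegularU q h u → SuperR.RegularU q h w → SuperR.RegularU q h (u + w) →
      SuperR.RegularZ q h z → (∀ γ : SuperR.Idx n, SuperR.RegularZ q h (SuperR.shift h z γ)) →
      SuperR.leg12 (fun _ => SuperR.rMat q h u z) *
          SuperR.leg13 (fun γ => SuperR.rMat q h (u + w) (SuperR.shift h z γ)) *
          SuperR.leg23 (fun _ => SuperR.rMat q h w z) =
        SuperR.leg23 (fun γ => SuperR.rMat q h w (SuperR.shift h z γ)) *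
          SuperR.leg13 (fun _ => SuperR.rMat q h (u + w) z) *
          SuperR.leg12 (fun γ => SuperR.rMat q h u (SuperR.shift h z γ))) ∧
    -- the shifts, explicitly
    (∀ (α : SuperR.Idx n) (i : Fin n),
      (α.val = 0 → SuperR.mu α i = if i.val + 1 = 1 then 1 else 0) ∧
      (0 < α.val → α.val < n → SuperR.mu α i =
        if i.val + 1 = α.val then -1 else if i.val + 1 = α.val + 1 then 1 else 0) ∧
      (α.val = n → SuperR.mu α i = if i.val + 1 = n then 1 else 0)) ∧
    -- the shifts are the weights of the fundamental representation of sl(n|1)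
    (LinearIndependent ℂ (SuperR.chevH (n := n)) ∧
      Submodule.span ℂ (Set.range (SuperR.chevH (n := n))) = SuperR.cartanSub n ∧
      (∀ i j : Fin n,
        SuperR.superBracket (SuperR.chevH i) (SuperR.chevE j) =
            (SuperR.cartanMatrix n i j : ℂ) • SuperR.chevE j ∧
        SuperR.superBracket (SuperR.chevH i) (SuperR.chevF j) =
            -(SuperR.cartanMatrix n i j : ℂ) • SuperR.chevF j) ∧
      (∀ (i : Fin n) (α : SuperR.Idx n),
        (SuperR.chevH i).mulVec (Pi.single α 1) = (SuperR.mu α i : ℂ) • Pi.single α 1)) ∧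
    -- the rational limit, through the trigonometric limit at any generic slope
    (∀ s : Fin n → ℝ, SuperR.GenericSlope s →
      ∃ T : ℂ → ℂ → SuperR.Op2 n,
        (∀ h u : ℂ, Complex.exp u ≠ Complex.exp h →
          Tendsto (fun p : ℂ × (Fin n → ℂ) => SuperR.rMat p.1 h u p.2)
            (SuperR.slopeFilter s) (𝓝 (T h u))) ∧
        (∀ h u : ℂ, u ≠ h →
          Tendsto (fun ε : ℂ => T (ε * h) (ε * u)) (𝓝[≠] 0) (𝓝 (SuperR.rRat n h u)))) := by
  refine ⟨?_, SuperR.mu_explicit, ⟨SuperR.linearIndependent_chevH, SuperR.span_chevH,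
    fun i j => ⟨SuperR.superBracket_chevH_chevE i j, SuperR.superBracket_chevH_chevF i j⟩,
    SuperR.chevH_mulVec_single⟩, fun s hs => ⟨SuperR.trigMat s, ?_, ?_⟩⟩
  · intro q h u w z h0 hq hu hw huw hz hs
    exact SuperR.rMat_yangBaxter hn h0 hq hu hw huw hz hs
  · exact fun h u hu => SuperR.tendsto_rMat hs hu
  · exact fun h u hu => SuperR.tendsto_trigMat s hu
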